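/- For $f:\mathbb{R}^2\to\mathbb{R}$ and $Q\subseteq\mathbb{R}^2$ let $\mathrm{Var}(f,Q)\in[0,\infty]$ be the Vitali variation of $f$ over $Q$: the supremum, over all compact rectangles $[a,b]\times[c,d]\subseteq Q$ and all partitions $a=x_0<\dots<x_n=b$, $c=y_0<\dots<y_m=d$, of $$\sum_{i=1}^n\sum_{j=1}^m\bigl|f(x_i,y_j)-f(x_{i-1},y_j)-f(x_i,y_{j-1})+f(x_{i-1},y_{j-1})\bigr|.$$ Let $BV_{\|0\|}(\mathbb{R}^2)$ be the set of $f:\mathbb{R}^2\to\mathbb{R}$ with $\mathrm{Var}(f,\mathbb{R}^2)<\infty$ and $f(x,y)\to0$ as $\|(x,y)\|\to\infty$. An increasing (not necessarily strictly) sequence $(u_j)_{j\ge1}$ of positive reals satisfies condition (L) with constant $A>1$ if $u_m\sum_{j=m}^\infty 1/u_j\le A$ for all $m\ge1$ (in particular the series converges). The KP-Fourier transform of $f$ at $(\xi,\eta)$ is $$\mathcal{F}(f)(\xi,\eta)=\lim_{\substack{a,c\to-\infty\\ b,d\to\infty}}\iint_{[a,b]\times[c,d]}f(t_1,t_2)e^{-i(\xi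 t_1+\eta t_2)}\,d(t_1,t_2),$$ where the integrals are Kurzweil–Henstock integrals (required to exist over every compact rectangle) and $a,b,c,d$ tend to their limits independently. For $\alpha_1,\alpha_2>0$ and real $\beta_1,\beta_2$ let $$R_{\alpha_1,\alpha_2}^{\beta_1,\beta_2}=\{(\xi,\eta)\in\mathbb{R}^2:\alpha_1\le|\xi|\le\beta_1,\ \alpha_2\le|\eta|\le\beta_2\}.$$ **Theorem.** Let $f\in BV_{\|0\|}(\mathbb{R}^2)$, and let $(u_n)_{n\ge1}$ and $(v_m)_{m\ge1}$ satisfy condition (L) with constants $A_1$ and $A_2$, respectively. Then $\mathcal{F}(f)(\xi,\eta)$ exists for all $\xi\ne0$, $\eta\ne0$, and for every $(x,y)\in\mathbb{R}^2$ the function $(\xi,\eta)\mapsto\mathcal{F}(f)(\xi,\eta)e^{i(x\xi+y\eta)}$ is Lebesgue integrable over every set $R_{\alpha_1,\alpha_2}^{\beta_1,\beta_2}$ with $\alpha_1,\alpha_2>0$, and $$\sum_{i,j=2}^\infty\ \sup_{u\in[u_{i-1},u_i]}\ \sup_{v\in[v_{j-1},v_j]}\left|\frac{1}{4\pi^2}\iint_{R_{u_{i-1},v_{j-1}}^{u,v}}\mathcal{F}(f)(\xi,\eta)e^{i(x\xi+y\eta)}\,d(\xi,\eta)\right|\le\frac{(3A_1+4)(3A_2+4)}{\pi^2}\,\mathrm{Var}(f,\mathbb{R}^2).$$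 -/

import Mathlib

open Set Filter Topology MeasureTheory
open scoped ENNReal

noncomputable section

/-- `a = s 0 < s 1 < ⋯ < s n = b`: the points of a partition of `[a, b]`. -/
def IsPartitionOf (a b : ℝ) (n : ℕ) (s : ℕ → ℝ) : Prop :=
  s 0 = a ∧ s n = b ∧ ∀ i < n, s i < s (i + 1)

/-- The mixed second difference of `f` over `[x₀, x₁] × [y₀, y₁]`. -/
def mixedDiff (f : ℝ × ℝ → ℝ) (x₀ x₁ y₀ y₁ : ℝ) : ℝ :=
  f (x₁, y₁) - f (x₀, y₁) - f (x₁, y₀) + f (x₀, y₀)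

/-- `Var(f, Q)`: the variation of `f` over `Q` in the sense of Vitali, the supremum over all
compact rectangles `[a, b] × [c, d] ⊆ Q` and all grid partitions of such a rectangle. -/
def vitaliVar (f : ℝ × ℝ → ℝ) (Q : Set (ℝ × ℝ)) : ℝ≥0∞ :=
  ⨆ (a : ℝ) (b : ℝ) (c : ℝ) (d : ℝ) (_ : Icc a b ×ˢ Icc c d ⊆ Q)
    (n : ℕ) (m : ℕ) (s : ℕ → ℝ) (t : ℕ → ℝ)
    (_ : IsPartitionOf a b n s) (_ : IsPartitionOf c d m t),
    ∑ i ∈ Finset.range n, ∑ j ∈ Finset.range m,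
      ENNReal.ofReal |mixedDiff f (s i) (s (i + 1)) (t j) (t (j + 1))|

/-- `BV_{‖0‖}(ℝ²)`: functions of bounded variation in the sense of Vitali over the plane that
vanish as the norm of the argument tends to infinity. -/
structure IsBVVanishing (f : ℝ × ℝ → ℝ) : Prop where
  var_lt_top : vitaliVar f univ < ∞
  tendsto_zero : Tendsto f (Bornology.cobounded (ℝ × ℝ)) (𝓝 0)

/-- Condition (L) with constant `A` for a sequence `u₁, u₂, u₃, …`; the value `u 0` plays
no role. -/
structure LacunaryWith (u : ℕ → ℝ) (A : ℝ) : Prop where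
  one_lt : 1 < A
  pos : ∀ n, 1 ≤ n → 0 < u n
  mono : ∀ n, 1 ≤ n → u n ≤ u (n + 1)
  summable : Summable fun j : ℕ => 1 / u (1 + j)
  le : ∀ m, 1 ≤ m → u m * ∑' j : ℕ, 1 / u (m + j) ≤ A

/-- The rectangle with sides from `a` to `b` and from `c` to `d`, as a box. -/
def planeBox (a b c d : ℝ) (hab : a < b) (hcd : c < d) : BoxIntegral.Box (Fin 2) where
  lower := ![a, c]
  upper := ![b, d]
  lower_lt_upper := by
    intro i
    fin_cases i
    · exact hab
    · exact hcd

/-- `g` is Kurzweil–Henstock integrable over every compact rectangle. -/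
def KHLoc (g : ℝ × ℝ → ℂ) : Prop :=
  ∀ (a b c d : ℝ) (hab : a < b) (hcd : c < d),
    BoxIntegral.Integrable (planeBox a b c d hab hcd) BoxIntegral.IntegrationParams.Henstock
      (fun p : Fin 2 → ℝ => g (p 0, p 1)) BoxIntegral.BoxAdditiveMap.volume

open Classical in
/-- The Kurzweil–Henstock integral of `g` over `[a, b] × [c, d]`, for `a < b` and `c < d`. -/
def khIntegral (g : ℝ × ℝ → ℂ) (a b c d : ℝ) : ℂ :=
  if h : a < b ∧ c < d then
    BoxIntegral.integral (planeBox a b c d h.1 h.2) BoxIntegral.IntegrationParams.Henstock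
      (fun p : Fin 2 → ℝ => g (p 0, p 1)) BoxIntegral.BoxAdditiveMap.volume
  else 0

/-- The function `(t₁, t₂) ↦ f(t₁, t₂) e^{-i(ξ t₁ + η t₂)}`. -/
def fourierIntegrand (f : ℝ × ℝ → ℝ) (ξ η : ℝ) (t : ℝ × ℝ) : ℂ :=
  (f t : ℂ) * Complex.exp (-(Complex.I * ((ξ * t.1 + η * t.2 : ℝ) : ℂ)))

/-- The KP-Fourier transform of `f` at `(ξ, η)` exists and equals `z`: the integrals over
`[a, b] × [c, d]` exist and tend to `z` as `a, c → -∞` and `b, d → ∞` independently. -/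
def HasKPFourier (f : ℝ × ℝ → ℝ) (ξ η : ℝ) (z : ℂ) : Prop :=
  KHLoc (fourierIntegrand f ξ η) ∧
    Tendsto
      (fun q : (ℝ × ℝ) × (ℝ × ℝ) =>
        khIntegral (fourierIntegrand f ξ η) q.1.1 q.1.2 q.2.1 q.2.2)
      ((atBot ×ˢ atTop) ×ˢ (atBot ×ˢ atTop)) (𝓝 z)

open Classical in
/-- The KP-Fourier transform of `f` at `(ξ, η)` (zero where it does not exist). -/
def kpFourier (f : ℝ × ℝ → ℝ) (ξ η : ℝ) : ℂ :=
  if h : ∃ z, HasKPFourier f ξ η z then h.choose else 0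

theorem HasKPFourier.kpFourier_eq {f : ℝ × ℝ → ℝ} {ξ η : ℝ} {z : ℂ}
    (h : HasKPFourier f ξ η z) : kpFourier f ξ η = z := by
  have hex : ∃ z, HasKPFourier f ξ η z := ⟨z, h⟩
  unfold kpFourier
  rw [dif_pos hex]
  exact tendsto_nhds_unique hex.choose_spec.2 h.2

/-- The set of `(ξ, η)` with `α₁ ≤ |ξ| ≤ β₁` and `α₂ ≤ |η| ≤ β₂`. -/
def truncRegion (α₁ β₁ α₂ β₂ : ℝ) : Set (ℝ × ℝ) :=
  {p | (α₁ ≤ |p.1| ∧ |p.1| ≤ β₁) ∧ (α₂ ≤ |p.2| ∧ |p.2| ≤ β₂)}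

/-- The function `(ξ, η) ↦ 𝓕(f)(ξ, η) e^{i(xξ + yη)}`. -/
def inverseIntegrand (f : ℝ × ℝ → ℝ) (x y : ℝ) (p : ℝ × ℝ) : ℂ :=
  kpFourier f p.1 p.2 * Complex.exp (Complex.I * ((x * p.1 + y * p.2 : ℝ) : ℂ))

/-- The truncated inverse integral at `(x, y)`, with the factor `1 / (4π²)`. -/
def truncInverse (f : ℝ × ℝ → ℝ) (x y α₁ β₁ α₂ β₂ : ℝ) : ℂ :=
  (1 / (4 * (Real.pi : ℂ) ^ 2)) * ∫ p in truncRegion α₁ β₁ α₂ β₂, inverseIntegrand f x y p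

end

/-! Because `f` has finite Vitali variation and vanishes at infinity, integration by parts in both
variables turns -ξη 𝓕(f)(ξ, η) into the Fourier–Stieltjes transform of the "measure" df, without
boundary terms. No measure is constructed: df is replaced by the mixed differences of `f` on uniform
grids over growing squares, and `tendsto_squareStieltjesSum` gives pointwise convergence off the
axes. Boundary terms are controlled by the variation V(x) of `f` over the half-plane to the left of
x: increments of V dominate `f` over vertical strips, and its tails dominate `f` and its variation
along vertical lines (`exists_stripControl`). The same control yields measurability, boundedness and
existence of 𝓕(f).

A mixed difference at the node (X, Y) enters the inverse integrand through the kernel e^{i(x-X)ξ}/ξ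
· e^{i(y-Y)η}/η, up to sign. On a symmetric region the even parts cancel, leaving in each variable
2i ∫ sin(τξ)/ξ dξ. So everything reduces to a bound, uniform in τ, for the sum over blocks of
truncated sine integrals (`LacunaryWith.sum_sineBound_le`). Blocks below 1/|τ| contribute at most
|τ| times their length, in total at most 1; the one block straddling 1/|τ| costs at most 3; beyond
it the bound 2/(|τ|u_j) and condition (L) give at most 2A. Weighting the product of two such sums by
mixed differences of total mass at most Var(f), with the factor 4/(4π²) = 1/π², and letting the
grids grow under dominated convergence gives the theorem. -/

noncomputable section

/-! ### Vitali variation as the variation of the curve of sections -/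

/-- Functions on the line, with the variation of the difference as a pseudo-distance. -/
def VariationSpace : Type := ℝ → ℝ

/-- With this pseudo-distance the Vitali variation becomes the ordinary variation of x ↦ f(x, ·), so
that additivity over adjacent intervals is inherited from `eVariationOn`. Distances may be infinite,
and vanish between functions differing by a constant. -/
instance : PseudoEMetricSpace VariationSpace where
  edist g h := eVariationOn (fun y => (g y - h y : ℝ)) univ
  edist_self g := by
    simp only [sub_self]
    exact eVariationOn.constant_on (by rintro _ ⟨_, _, rfl⟩ _ ⟨_, _, rfl⟩; rfl)
  edist_comm g h := by
    simp only [eVariationOn]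
    congr! 3 with p i
    simp only [edist_dist, Real.dist_eq]
    rw [← abs_neg]
    ring_nf
  edist_triangle g h k := by
    refine iSup_le fun p => ?_
    calc _ ≤ ∑ i ∈ Finset.range p.1,
          (edist (g (p.2.1 (i + 1)) - h (p.2.1 (i + 1))) (g (p.2.1 i) - h (p.2.1 i)) +
            edist (h (p.2.1 (i + 1)) - k (p.2.1 (i + 1))) (h (p.2.1 i) - k (p.2.1 i))) := by
          refine Finset.sum_le_sum fun i _ => ?_
          simp only [edist_dist, Real.dist_eq]
          rw [← ENNReal.ofReal_add (abs_nonneg _) (abs_nonneg _)]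
          refine ENNReal.ofReal_le_ofReal (le_trans (le_of_eq ?_) (abs_add_le _ _))
          ring_nf
      _ ≤ _ := by
          rw [Finset.sum_add_distrib]
          exact add_le_add (eVariationOn.sum_le p.2.2.1 p.2.2.2)
            (eVariationOn.sum_le p.2.2.1 p.2.2.2)

/-- The section `y ↦ f (x, y)`. -/
def verticalSection (f : ℝ × ℝ → ℝ) (x : ℝ) : VariationSpace := fun y => f (x, y)

theorem edist_verticalSection (f : ℝ × ℝ → ℝ) (a b : ℝ) :
    edist (verticalSection f b) (verticalSection f a) =
      eVariationOn (fun y => f (b, y) - f (a, y)) univ := rfl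

/-- Writes the variation as a supremum over a directed family, which can be exchanged with finite
sums. -/
theorem eVariationOn_univ_eq_iSup_finset {α E : Type*} [LinearOrder α] [PseudoEMetricSpace E]
    (g : α → E) : eVariationOn g univ = ⨆ T : Finset α, eVariationOn g (T : Set α) := by
  refine le_antisymm (iSup_le fun p => ?_) (iSup_le fun T => eVariationOn.mono _ (subset_univ _))
  refine le_iSup_of_le ((Finset.range (p.1 + 1)).image p.2.1) ?_
  refine eVariationOn.sum_le_of_monotoneOn_Iic (p.2.2.1.monotoneOn _) fun i hi => ?_
  simp only [Finset.coe_image, Finset.coe_range]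
  exact ⟨i, Nat.lt_succ_of_le hi, rfl⟩

theorem exists_strictMonoOn_image_Iic {α : Type*} [LinearOrder α] (T : Finset α)
    (hT : T.Nonempty) :
    ∃ (m : ℕ) (t : ℕ → α), Monotone t ∧ StrictMonoOn t (Iic m) ∧ (T : Set α) = t '' Iic m := by
  have hc := T.card_pos.2 hT
  refine ⟨T.card - 1, fun n => T.orderEmbOfFin rfl ⟨min n (T.card - 1), by grind⟩, ?_, ?_, ?_⟩
  · exact fun _ _ _ => OrderEmbedding.monotone _ (by grind)
  · intro i hi j hj hij
    refine OrderEmbedding.strictMono _ ?_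
    simp only [mem_Iic] at hi hj
    show min i (T.card - 1) < min j (T.card - 1)
    omega
  · ext
    simp only [← T.range_orderEmbOfFin rfl, mem_image, mem_Iic, mem_range]
    constructor
    · rintro ⟨i, rfl⟩; exact ⟨i.val, by grind⟩
    · rintro ⟨i, hi, rfl⟩; use ⟨i, by omega⟩; congr; omega

theorem edist_sub_eq_mixedDiff (f : ℝ × ℝ → ℝ) (a b c d : ℝ) :
    edist (f (b, c) - f (a, c)) (f (b, d) - f (a, d)) = ENNReal.ofReal |mixedDiff f a b c d| := by
  rw [edist_dist, Real.dist_eq, mixedDiff, ← abs_neg]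
  ring_nf

theorem sum_mixedDiff_le_vitaliVar (f : ℝ × ℝ → ℝ) (n m : ℕ) (s t : ℕ → ℝ)
    (hs : ∀ i < n, s i < s (i + 1)) (ht : ∀ j < m, t j < t (j + 1)) :
    ∑ i ∈ Finset.range n, ∑ j ∈ Finset.range m,
      ENNReal.ofReal |mixedDiff f (s i) (s (i + 1)) (t j) (t (j + 1))| ≤ vitaliVar f univ := by
  unfold vitaliVar
  refine le_iSup_of_le (s 0) <| le_iSup_of_le (s n) <| le_iSup_of_le (t 0) <|
    le_iSup_of_le (t m) <| le_iSup_of_le (subset_univ _) <| le_iSup_of_le n <|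
    le_iSup_of_le m <| le_iSup_of_le s <| le_iSup_of_le t <|
    le_iSup_of_le ⟨rfl, rfl, hs⟩ <| le_iSup_of_le ⟨rfl, rfl, ht⟩ le_rfl

/-- Each increment of the curve of sections is itself a supremum over partitions in y. Finitely many
of them share a common refinement, and that leaves a grid sum. -/
theorem eVariationOn_verticalSection_le (f : ℝ × ℝ → ℝ) :
    eVariationOn (verticalSection f) univ ≤ vitaliVar f univ := by
  rw [eVariationOn.eVariationOn_eq_strictMonoOn]
  refine iSup_le fun ⟨n, s, hs, _⟩ => ?_
  simp only [edist_verticalSection, eVariationOn_univ_eq_iSup_finset]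
  -- Variation on a finite set grows with the set, so one `T` serves all strips at once.
  rw [ENNReal.finsetSum_iSup_of_monotone
    (f := fun i (T : Finset ℝ) => eVariationOn (fun y => f (s (i + 1), y) - f (s i, y)) (T : Set ℝ))
    (fun i T T' h => eVariationOn.mono _ (Finset.coe_subset.2 h))]
  refine iSup_le fun T => ?_
  rcases T.eq_empty_or_nonempty with rfl | hT
  · simp
  obtain ⟨m, t, ht, ht', hTt⟩ := exists_strictMonoOn_image_Iic T hT
  simp only [hTt, eVariationOn.image_range_of_monotone _ ht, edist_sub_eq_mixedDiff]
  refine sum_mixedDiff_le_vitaliVar f n m s t (fun i hi => hs ?_ ?_ (Nat.lt_succ_self i))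
    (fun i hi => ht' ?_ ?_ (Nat.lt_succ_self i)) <;> simp only [mem_Iic] <;> omega

/-- The mass function in the first variable of the variation of `f`. -/
theorem exists_monotone_sum_mixedDiff_le {f : ℝ × ℝ → ℝ} (hf : vitaliVar f univ < ∞) :
    ∃ V : ℝ → ℝ, Monotone V ∧ (∀ x, 0 ≤ V x) ∧ (∀ x, V x ≤ (vitaliVar f univ).toReal) ∧
      ∀ a b, a ≤ b → ∀ (m : ℕ) (t : ℕ → ℝ), Monotone t →
        ∑ j ∈ Finset.range m, |mixedDiff f a b (t j) (t (j + 1))| ≤ V b - V a := by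
  have hle : ∀ s, eVariationOn (verticalSection f) s ≤ vitaliVar f univ := fun s =>
    (eVariationOn.mono _ (subset_univ s)).trans (eVariationOn_verticalSection_le f)
  have hfin : ∀ s, eVariationOn (verticalSection f) s ≠ ∞ := fun s => ((hle s).trans_lt hf).ne
  refine ⟨fun x => (eVariationOn (verticalSection f) (Iic x)).toReal, ?_,
    fun x => ENNReal.toReal_nonneg, fun x => ENNReal.toReal_mono hf.ne (hle _), ?_⟩
  · exact fun a b hab => ENNReal.toReal_mono (hfin _) (eVariationOn.mono _ (Iic_subset_Iic.2 hab))
  · intro a b hab m t ht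
    -- Additivity at `a` makes the increment of V exactly the variation over the strip between `a`
    -- and `b`.
    have hun : eVariationOn (verticalSection f) (Iic b) =
        eVariationOn (verticalSection f) (Iic a) + eVariationOn (verticalSection f) (Icc a b) := by
      rw [← eVariationOn.union _ (isGreatest_Iic) (isLeast_Icc hab), Iic_union_Icc_eq_Iic hab]
    simp only [hun]
    rw [ENNReal.toReal_add (hfin _) (hfin _), add_sub_cancel_left,
      ← ENNReal.ofReal_le_iff_le_toReal (hfin _),
      ENNReal.ofReal_sum_of_nonneg fun _ _ => abs_nonneg _]
    calc _ = ∑ j ∈ Finset.range m,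
            edist (f (b, t (j + 1)) - f (a, t (j + 1))) (f (b, t j) - f (a, t j)) := by
          simp only [← edist_sub_eq_mixedDiff, edist_comm]
      _ ≤ edist (verticalSection f b) (verticalSection f a) := by
          rw [edist_verticalSection]
          exact eVariationOn.sum_le (f := fun y => f (b, y) - f (a, y)) ht fun _ => mem_univ _
      _ ≤ _ := eVariationOn.edist_le _ (right_mem_Icc.2 hab) (left_mem_Icc.2 hab)

theorem vitaliVar_comp_swap_le (f : ℝ × ℝ → ℝ) :
    vitaliVar (f ∘ Prod.swap) univ ≤ vitaliVar f univ := by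
  conv_lhs => unfold vitaliVar
  simp only [iSup_le_iff]
  intro a b c d _ n m s t hs ht
  rw [Finset.sum_comm]
  refine le_trans (le_of_eq ?_) (sum_mixedDiff_le_vitaliVar f m n t s ht.2.2 hs.2.2)
  refine Finset.sum_congr rfl fun j _ => Finset.sum_congr rfl fun i _ => ?_
  simp only [mixedDiff, Function.comp, Prod.swap]
  ring_nf

/-! ### Control of `f` by monotone functions of one variable -/

/-- `V` dominates the variation of `f` over vertical strips, and `e` dominates `f` and its
variation along vertical lines. -/
structure StripControl (f : ℝ × ℝ → ℝ) (V e : ℝ → ℝ) (C : ℝ) : Prop where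
  mono : Monotone V
  nonneg : ∀ x, 0 ≤ V x
  le : ∀ x, V x ≤ C
  mixed : ∀ a b, a ≤ b → ∀ (m : ℕ) (t : ℕ → ℝ), Monotone t →
    ∑ j ∈ Finset.range m, |mixedDiff f a b (t j) (t (j + 1))| ≤ V b - V a
  sub_le : ∀ a b y, a ≤ b → |f (b, y) - f (a, y)| ≤ V b - V a
  edge : ∀ x (m : ℕ) (t : ℕ → ℝ), Monotone t →
    ∑ j ∈ Finset.range m, |f (x, t (j + 1)) - f (x, t j)| ≤ e x
  abs_le : ∀ x y, |f (x, y)| ≤ e x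
  tendsto_atTop : Tendsto e atTop (𝓝 0)
  tendsto_atBot : Tendsto e atBot (𝓝 0)

theorem tendsto_cobounded_prod_of_fst {ι : Type*} {l : Filter ι} {g : ι → ℝ} (y : ℝ)
    (hg : Tendsto (fun i => |g i|) l atTop) :
    Tendsto (fun i => (g i, y)) l (Bornology.cobounded (ℝ × ℝ)) := by
  rw [← tendsto_norm_atTop_iff_cobounded]
  exact tendsto_atTop_mono (fun i => norm_fst_le (g i, y)) hg

theorem tendsto_cobounded_prod_of_snd {ι : Type*} {l : Filter ι} {g : ι → ℝ} (x : ℝ)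
    (hg : Tendsto (fun i => |g i|) l atTop) :
    Tendsto (fun i => (x, g i)) l (Bornology.cobounded (ℝ × ℝ)) := by
  rw [← tendsto_norm_atTop_iff_cobounded]
  exact tendsto_atTop_mono (fun i => norm_snd_le (x, g i)) hg

/-- Mixed differences become plain differences or values when the remaining corners are sent to
infinity, where `f` vanishes. -/
theorem exists_stripControl {f : ℝ × ℝ → ℝ} (hf : IsBVVanishing f) :
    ∃ V e, StripControl f V e (vitaliVar f univ).toReal := by
  obtain ⟨V, hV, h0, hC, hmix⟩ := exists_monotone_sum_mixedDiff_le hf.var_lt_top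
  have hbA : BddAbove (range V) := ⟨_, by rintro _ ⟨x, rfl⟩; exact hC x⟩
  have hbB : BddBelow (range V) := ⟨0, by rintro _ ⟨x, rfl⟩; exact h0 x⟩
  have hp : ∀ x, V x ≤ ⨆ z, V z := fun x => le_ciSup hbA x
  have hq : ∀ x, ⨅ z, V z ≤ V x := fun x => ciInf_le hbB x
  have htop : ∀ y, Tendsto (fun x => f (x, y)) atTop (𝓝 0) := fun y =>
    hf.tendsto_zero.comp (tendsto_cobounded_prod_of_fst y tendsto_abs_atTop_atTop)
  have hbot : ∀ y, Tendsto (fun x => f (x, y)) atBot (𝓝 0) := fun y =>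
    hf.tendsto_zero.comp (tendsto_cobounded_prod_of_fst y tendsto_abs_atBot_atTop)
  have hvert : ∀ x, Tendsto (fun y => f (x, y)) atTop (𝓝 0) := fun x =>
    hf.tendsto_zero.comp (tendsto_cobounded_prod_of_snd x tendsto_abs_atTop_atTop)
  have hsub : ∀ a b y, a ≤ b → |f (b, y) - f (a, y)| ≤ V b - V a := by
    intro a b y hab
    have hlim : Tendsto (fun y' => |f (b, y) - f (a, y) - f (b, y') + f (a, y')|) atTop
        (𝓝 |f (b, y) - f (a, y) - 0 + 0|) :=
      ((tendsto_const_nhds.sub (hvert b)).add (hvert a)).abs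
    rw [sub_zero, add_zero] at hlim
    refine le_of_tendsto hlim ?_
    filter_upwards [eventually_ge_atTop y] with y' hy'
    -- The partition with the two nodes `y` and `y'`; then `y'` tends to infinity.
    have := hmix a b hab 1 (fun j => if j = 0 then y else y') ?_
    · simp only [Finset.sum_range_one, mixedDiff] at this
      refine le_trans (le_of_eq ?_) this
      rw [← abs_neg]
      simp only [if_true, zero_add, one_ne_zero, if_false]
      ring_nf
    · intro i j hij
      by_cases hi : i = 0 <;> by_cases hj : j = 0 <;> simp_all
  have hedge : ∀ x x' (m : ℕ) (t : ℕ → ℝ), Monotone t → ∀ B, |V x' - V x| ≤ B →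
      ∑ j ∈ Finset.range m, |f (x, t (j + 1)) - f (x, t j)| -
        ∑ j ∈ Finset.range m, |f (x', t (j + 1)) - f (x', t j)| ≤ B := by
    intro x x' m t ht B hB
    have key : ∑ j ∈ Finset.range m, |mixedDiff f x x' (t j) (t (j + 1))| ≤ B := by
      rcases le_total x x' with h | h
      · exact (hmix x x' h m t ht).trans ((le_abs_self _).trans hB)
      · refine le_trans (le_of_eq ?_) ((hmix x' x h m t ht).trans
          (((le_abs_self _).trans (le_of_eq (abs_sub_comm _ _))).trans hB))
        refine Finset.sum_congr rfl fun j _ => ?_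
        rw [← abs_neg, mixedDiff, mixedDiff]
        ring_nf
    refine le_trans ?_ key
    rw [← Finset.sum_sub_distrib]
    refine Finset.sum_le_sum fun j _ => ?_
    refine (abs_sub_abs_le_abs_sub _ _).trans (le_of_eq ?_)
    rw [← abs_neg, mixedDiff]
    ring_nf
  have hsum0 : ∀ (l : Filter ℝ) (m : ℕ) (t : ℕ → ℝ),
      (∀ y, Tendsto (fun x => f (x, y)) l (𝓝 0)) →
      Tendsto (fun x' => ∑ j ∈ Finset.range m, |f (x', t (j + 1)) - f (x', t j)|) l (𝓝 0) := by
    intro l m t h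
    have := tendsto_finsetSum (Finset.range m)
      fun j _ => ((h (t (j + 1))).sub (h (t j))).abs
    simpa using this
  -- Comparison with a line moved to +∞ or to -∞ gives two bounds, the mass of V to the right and to
  -- the left of `x`. The first decays at +∞ and the second at -∞, so their minimum decays at both
  -- ends.
  refine ⟨V, fun x => min ((⨆ z, V z) - V x) (V x - ⨅ z, V z), hV, h0, hC, hmix, hsub, ?_, ?_, ?_, ?_⟩
  · intro x m t ht
    refine le_min ?_ ?_
    · have hlim := (tendsto_const_nhds (x := ∑ j ∈ Finset.range m,
        |f (x, t (j + 1)) - f (x, t j)|)).sub (hsum0 atTop m t htop)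
      rw [sub_zero] at hlim
      refine le_of_tendsto hlim ?_
      filter_upwards [eventually_ge_atTop x] with x' hx'
      refine hedge x x' m t ht _ ?_
      rw [abs_of_nonneg (sub_nonneg.2 (hV hx'))]
      exact sub_le_sub_right (hp x') _
    · have hlim := (tendsto_const_nhds (x := ∑ j ∈ Finset.range m,
        |f (x, t (j + 1)) - f (x, t j)|)).sub (hsum0 atBot m t hbot)
      rw [sub_zero] at hlim
      refine le_of_tendsto hlim ?_
      filter_upwards [eventually_le_atBot x] with x' hx'
      refine hedge x x' m t ht _ ?_
      rw [abs_sub_comm, abs_of_nonneg (sub_nonneg.2 (hV hx'))]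
      exact sub_le_sub_left (hq x') _
  · intro x y
    refine le_min ?_ ?_
    · have hlim := ((htop y).sub_const (f (x, y))).abs
      rw [zero_sub, abs_neg] at hlim
      refine le_of_tendsto hlim ?_
      filter_upwards [eventually_ge_atTop x] with x' hx'
      exact (hsub x x' y hx').trans (sub_le_sub_right (hp x') _)
    · have hlim := ((hbot y).const_sub (f (x, y))).abs
      rw [sub_zero] at hlim
      refine le_of_tendsto hlim ?_
      filter_upwards [eventually_le_atBot x] with x' hx'
      exact (hsub x' x y hx').trans (sub_le_sub_left (hq x') _)
  · have h := (tendsto_atTop_ciSup hV hbA).const_sub (⨆ z, V z)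
    rw [sub_self] at h
    exact tendsto_of_tendsto_of_tendsto_of_le_of_le tendsto_const_nhds h
      (fun x => le_min (sub_nonneg.2 (hp x)) (sub_nonneg.2 (hq x))) (fun x => min_le_left _ _)
  · have h := (tendsto_atBot_ciInf hV hbB).sub_const (⨅ z, V z)
    rw [sub_self] at h
    exact tendsto_of_tendsto_of_tendsto_of_le_of_le tendsto_const_nhds h
      (fun x => le_min (sub_nonneg.2 (hp x)) (sub_nonneg.2 (hq x))) (fun x => min_le_right _ _)

theorem IsBVVanishing.comp_swap {f : ℝ × ℝ → ℝ} (hf : IsBVVanishing f) :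
    IsBVVanishing (f ∘ Prod.swap) where
  var_lt_top := (vitaliVar_comp_swap_le f).trans_lt hf.var_lt_top
  tendsto_zero := by
    refine hf.tendsto_zero.comp ?_
    rw [← tendsto_norm_atTop_iff_cobounded]
    refine tendsto_norm_cobounded_atTop.congr fun p => ?_
    simp [Prod.norm_def, max_comm]

theorem StripControl.mono_const {f : ℝ × ℝ → ℝ} {V e : ℝ → ℝ} {C D : ℝ}
    (h : StripControl f V e C) (hCD : C ≤ D) : StripControl f V e D :=
  { h with le := fun x => (h.le x).trans hCD }

theorem exists_stripControl_swap {f : ℝ × ℝ → ℝ} (hf : IsBVVanishing f) :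
    ∃ V e, StripControl (f ∘ Prod.swap) V e (vitaliVar f univ).toReal := by
  obtain ⟨V, e, h⟩ := exists_stripControl hf.comp_swap
  exact ⟨V, e, h.mono_const (ENNReal.toReal_mono hf.var_lt_top.ne (vitaliVar_comp_swap_le f))⟩

section

variable {f : ℝ × ℝ → ℝ} {V e W d : ℝ → ℝ} {C : ℝ}

theorem StripControl.abs_sub_le (h : StripControl f V e C) (a b y : ℝ) :
    |f (b, y) - f (a, y)| ≤ |V b - V a| := by
  rcases le_total a b with hab | hab
  · exact (h.sub_le a b y hab).trans (le_abs_self _)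
  · rw [abs_sub_comm, abs_sub_comm (V b)]
    exact (h.sub_le b a y hab).trans (le_abs_self _)

theorem StripControl.abs_sub_le_add (h : StripControl f V e C)
    (h' : StripControl (f ∘ Prod.swap) W d C) (p q : ℝ × ℝ) :
    |f p - f q| ≤ |V p.1 - V q.1| + |W p.2 - W q.2| := by
  have h1 := h.abs_sub_le q.1 p.1 p.2
  have h2 := h'.abs_sub_le q.2 p.2 q.1
  simp only [Function.comp, Prod.swap] at h2
  calc |f p - f q| = |(f (p.1, p.2) - f (q.1, p.2)) + (f (q.1, p.2) - f (q.1, q.2))| := by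
        congr 1; ring
    _ ≤ _ := (abs_add_le _ _).trans (add_le_add h1 h2)

/-- The oscillation of `f` is dominated by increments of V and W, so `f` is a Lipschitz function of
(V(x), W(y)). Extending that function to the plane and using measurability of monotone functions
gives the claim. -/
theorem StripControl.measurable (h : StripControl f V e C)
    (h' : StripControl (f ∘ Prod.swap) W d C) : Measurable f := by
  set Φ : ℝ × ℝ → ℝ × ℝ := fun p => (V p.1, W p.2) with hΦ
  have hfΦ : ∀ p q, |f p - f q| ≤ 2 * dist (Φ p) (Φ q) := by
    intro p q
    refine (h.abs_sub_le_add h' p q).trans ?_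
    rw [two_mul]
    exact add_le_add (le_max_left _ _) (le_max_right _ _)
  have hinv : ∀ p, f (Function.invFun Φ (Φ p)) = f p := by
    intro p
    have := hfΦ (Function.invFun Φ (Φ p)) p
    rw [Function.invFun_eq (f := Φ) ⟨p, rfl⟩, dist_self, mul_zero] at this
    exact sub_eq_zero.1 (abs_eq_zero.1 (le_antisymm this (abs_nonneg _)))
  have hLip : LipschitzOnWith 2 (fun z => f (Function.invFun Φ z)) (range Φ) := by
    refine LipschitzOnWith.of_dist_le_mul ?_
    rintro _ ⟨p, rfl⟩ _ ⟨q, rfl⟩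
    simp only [hinv]
    exact hfΦ p q
  obtain ⟨g, hg, hgeq⟩ := hLip.extend_real
  have : f = g ∘ Φ := by
    ext p
    have h1 := hgeq (mem_range_self p)
    simp only [hinv] at h1
    exact h1
  rw [this]
  exact hg.continuous.measurable.comp
    ((h.mono.measurable.comp measurable_fst).prodMk (h'.mono.measurable.comp measurable_snd))

theorem StripControl.abs_apply_le (h : StripControl f V e C) (p : ℝ × ℝ) : |f p| ≤ C := by
  obtain ⟨x, y⟩ := p
  have hlim : Tendsto (fun x' => |f (x, y) - f (x', y)|) atTop (𝓝 |f (x, y)|) := by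
    have h0 : Tendsto (fun x' => f (x', y)) atTop (𝓝 0) :=
      squeeze_zero_norm (fun x' => h.abs_le x' y) h.tendsto_atTop
    simpa using (h0.const_sub (f (x, y))).abs
  refine le_of_tendsto hlim ?_
  filter_upwards [eventually_ge_atTop x] with x' hx'
  rw [abs_sub_comm]
  have := h.sub_le x x' y hx'
  linarith [h.le x', h.nonneg x]

end

/-! ### Summation by parts in two variables -/

theorem sum_range_mul_sub_eq (n : ℕ) (g A : ℕ → ℂ) :
    ∑ i ∈ Finset.range n, g i * (A (i + 1) - A i) =
      g n * A n - g 0 * A 0 - ∑ i ∈ Finset.range n, (g (i + 1) - g i) * A (i + 1) := by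
  induction n with
  | zero => simp
  | succ n ih => rw [Finset.sum_range_succ, Finset.sum_range_succ, ih]; ring

theorem norm_sum_mul_le {n : ℕ} {g A : ℕ → ℂ} (hA : ∀ i, ‖A i‖ ≤ 1) :
    ‖∑ i ∈ Finset.range n, g i * A (i + 1)‖ ≤ ∑ i ∈ Finset.range n, ‖g i‖ := by
  refine norm_sum_le_of_le _ fun i _ => ?_
  rw [norm_mul]
  exact mul_le_of_le_one_right (norm_nonneg _) (hA _)

/-- Summation by parts in two variables, with an estimate for the boundary terms. -/
theorem norm_sum_mul_sub_mul_sub_le (n m : ℕ) (g : ℕ → ℕ → ℂ) (A B : ℕ → ℂ)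
    (hA : ∀ i, ‖A i‖ ≤ 1) (hB : ∀ i, ‖B i‖ ≤ 1) :
    ‖∑ i ∈ Finset.range n, ∑ j ∈ Finset.range m, g i j * (A (i + 1) - A i) * (B (j + 1) - B j) -
      ∑ i ∈ Finset.range n, ∑ j ∈ Finset.range m,
        (g (i + 1) (j + 1) - g i (j + 1) - g (i + 1) j + g i j) * A (i + 1) * B (j + 1)‖ ≤
      (‖g n m‖ + ‖g 0 m‖ + ∑ i ∈ Finset.range n, ‖g (i + 1) m - g i m‖) +
      (‖g n 0‖ + ‖g 0 0‖ + ∑ i ∈ Finset.range n, ‖g (i + 1) 0 - g i 0‖) +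
      (∑ j ∈ Finset.range m, ‖g n (j + 1) - g n j‖ +
        ∑ j ∈ Finset.range m, ‖g 0 (j + 1) - g 0 j‖) := by
  set h : ℕ → ℂ := fun j => ∑ i ∈ Finset.range n, g i j * (A (i + 1) - A i) with hh
  have hj : ∀ j, h j = g n j * A n - g 0 j * A 0 -
      ∑ i ∈ Finset.range n, (g (i + 1) j - g i j) * A (i + 1) := fun j =>
    sum_range_mul_sub_eq n (fun i => g i j) A
  have e1 : ∑ i ∈ Finset.range n, ∑ j ∈ Finset.range m,
      g i j * (A (i + 1) - A i) * (B (j + 1) - B j) =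
      h m * B m - h 0 * B 0 - ∑ j ∈ Finset.range m, (h (j + 1) - h j) * B (j + 1) := by
    rw [← sum_range_mul_sub_eq, Finset.sum_comm]
    simp only [hh, Finset.sum_mul]
  have e2 : ∑ j ∈ Finset.range m, (h (j + 1) - h j) * B (j + 1) =
      (∑ j ∈ Finset.range m, (g n (j + 1) - g n j) * B (j + 1)) * A n -
      (∑ j ∈ Finset.range m, (g 0 (j + 1) - g 0 j) * B (j + 1)) * A 0 -
      ∑ i ∈ Finset.range n, ∑ j ∈ Finset.range m,
        (g (i + 1) (j + 1) - g i (j + 1) - g (i + 1) j + g i j) * A (i + 1) * B (j + 1) := by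
    rw [Finset.sum_comm, Finset.sum_mul, Finset.sum_mul, ← Finset.sum_sub_distrib,
      ← Finset.sum_sub_distrib]
    refine Finset.sum_congr rfl fun j _ => ?_
    have : ∑ i ∈ Finset.range n,
        (g (i + 1) (j + 1) - g i (j + 1) - g (i + 1) j + g i j) * A (i + 1) * B (j + 1) =
        (∑ i ∈ Finset.range n, (g (i + 1) (j + 1) - g i (j + 1)) * A (i + 1) -
          ∑ i ∈ Finset.range n, (g (i + 1) j - g i j) * A (i + 1)) * B (j + 1) := by
      rw [← Finset.sum_sub_distrib, Finset.sum_mul]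
      exact Finset.sum_congr rfl fun i _ => by ring
    rw [this, hj, hj]
    ring
  have hn : ∀ j, ‖h j‖ ≤ ‖g n j‖ + ‖g 0 j‖ + ∑ i ∈ Finset.range n, ‖g (i + 1) j - g i j‖ := by
    intro j
    rw [hj]
    refine (norm_sub_le _ _).trans (add_le_add ((norm_sub_le _ _).trans (add_le_add ?_ ?_))
      (norm_sum_mul_le (g := fun i => g (i + 1) j - g i j) hA)) <;> rw [norm_mul] <;>
      exact mul_le_of_le_one_right (norm_nonneg _) (hA _)
  have hb : ∀ (z w : ℂ), ‖w‖ ≤ 1 → ‖z * w‖ ≤ ‖z‖ := fun z w hw => by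
    rw [norm_mul]; exact mul_le_of_le_one_right (norm_nonneg _) hw
  rw [e1, e2]
  calc _ = ‖(h m * B m - h 0 * B 0) -
        ((∑ j ∈ Finset.range m, (g n (j + 1) - g n j) * B (j + 1)) * A n -
          (∑ j ∈ Finset.range m, (g 0 (j + 1) - g 0 j) * B (j + 1)) * A 0)‖ := by
        congr 1; ring
    _ ≤ (‖h m‖ + ‖h 0‖) + (∑ j ∈ Finset.range m, ‖g n (j + 1) - g n j‖ +
        ∑ j ∈ Finset.range m, ‖g 0 (j + 1) - g 0 j‖) := by
        refine (norm_sub_le _ _).trans (add_le_add ((norm_sub_le _ _).trans (add_le_add ?_ ?_))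
          ((norm_sub_le _ _).trans (add_le_add ?_ ?_)))
        · exact hb _ _ (hB m)
        · exact hb _ _ (hB 0)
        · exact (hb _ _ (hA n)).trans (norm_sum_mul_le (g := fun j => g n (j + 1) - g n j) hB)
        · exact (hb _ _ (hA 0)).trans (norm_sum_mul_le (g := fun j => g 0 (j + 1) - g 0 j) hB)
    _ ≤ _ := by gcongr <;> exact hn _

/-! ### Box integrals and Fourier–Stieltjes sums -/

theorem intervalIntegrable_of_measurable_of_norm_le {g : ℝ → ℂ} {C : ℝ} (hg : Measurable g)
    (hC : ∀ t, ‖g t‖ ≤ C) (c d : ℝ) : IntervalIntegrable g volume c d := by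
  rw [intervalIntegrable_iff]
  exact IntegrableOn.of_bound measure_Ioc_lt_top hg.aestronglyMeasurable C (ae_of_all _ hC)

theorem measurable_intervalIntegral_right {G : ℝ × ℝ → ℂ} (hG : Measurable G) (c d : ℝ) :
    Measurable fun s => ∫ t in c..d, G (s, t) := by
  simp only [intervalIntegral]
  exact (hG.stronglyMeasurable.integral_prod_right' (ν := volume.restrict (Ioc c d))).measurable.sub
    (hG.stronglyMeasurable.integral_prod_right' (ν := volume.restrict (Ioc d c))).measurable

theorem intervalIntegrable_intervalIntegral {G : ℝ × ℝ → ℂ} {C : ℝ} (hG : Measurable G)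
    (hC : ∀ p, ‖G p‖ ≤ C) (a b c d : ℝ) :
    IntervalIntegrable (fun s => ∫ t in c..d, G (s, t)) volume a b :=
  intervalIntegrable_of_measurable_of_norm_le (measurable_intervalIntegral_right hG c d)
    (fun _ => intervalIntegral.norm_integral_le_of_norm_le_const fun _ _ => hC _) a b

/-- The complex exponential `e^{-i ξ s}`. -/
def phase (ξ s : ℝ) : ℂ := Complex.exp (-(Complex.I * ((ξ * s : ℝ) : ℂ)))

theorem continuous_phase (ξ : ℝ) : Continuous (phase ξ) := by
  unfold phase; fun_prop

theorem norm_phase (ξ s : ℝ) : ‖phase ξ s‖ = 1 := by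
  rw [phase, ← mul_neg, mul_comm, ← Complex.ofReal_neg, Complex.norm_exp_ofReal_mul_I]

theorem fourierIntegrand_eq (f : ℝ × ℝ → ℝ) (ξ η : ℝ) (t : ℝ × ℝ) :
    fourierIntegrand f ξ η t = f t * phase ξ t.1 * phase η t.2 := by
  rw [fourierIntegrand, phase, phase, mul_assoc, ← Complex.exp_add]
  congr 2
  push_cast
  ring

theorem norm_fourierIntegrand (f : ℝ × ℝ → ℝ) (ξ η : ℝ) (t : ℝ × ℝ) :
    ‖fourierIntegrand f ξ η t‖ = |f t| := by
  simp [fourierIntegrand_eq, norm_phase]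

theorem integral_phase {ξ : ℝ} (hξ : ξ ≠ 0) (a b : ℝ) :
    -(Complex.I * ξ) * ∫ s in a..b, phase ξ s = phase ξ b - phase ξ a := by
  have hc : -(Complex.I * (ξ : ℂ)) ≠ 0 := by simp [hξ]
  have := integral_exp_mul_complex (a := a) (b := b) hc
  have h2 : ∀ s : ℝ, phase ξ s = Complex.exp (-(Complex.I * (ξ : ℂ)) * s) := by
    intro s; rw [phase]; congr 1; push_cast; ring
  simp only [h2, this]
  rw [mul_comm]
  exact div_mul_cancel₀ _ hc

/-- The integral of `f(s, t) e^{-i(ξ s + η t)}` over `[a, b] × [c, d]`. -/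
def boxFourier (f : ℝ × ℝ → ℝ) (ξ η a b c d : ℝ) : ℂ :=
  ∫ s in a..b, ∫ t in c..d, fourierIntegrand f ξ η (s, t)

theorem measurable_fourierIntegrand {f : ℝ × ℝ → ℝ} (hf : Measurable f) (ξ η : ℝ) :
    Measurable (fourierIntegrand f ξ η) := by
  unfold fourierIntegrand
  fun_prop

/-- The points of the uniform partition of `[a, b]` into `n` intervals. -/
def uniformGrid (a b : ℝ) (n i : ℕ) : ℝ := a + i * ((b - a) / n)

theorem uniformGrid_zero (a b : ℝ) (n : ℕ) : uniformGrid a b n 0 = a := by simp [uniformGrid]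

theorem uniformGrid_self (a b : ℝ) {n : ℕ} (hn : n ≠ 0) : uniformGrid a b n n = b := by
  rw [uniformGrid]; field_simp; ring

theorem uniformGrid_succ_sub (a b : ℝ) (n i : ℕ) :
    uniformGrid a b n (i + 1) - uniformGrid a b n i = (b - a) / n := by
  rw [uniformGrid, uniformGrid]; push_cast; ring

theorem monotone_uniformGrid {a b : ℝ} (hab : a ≤ b) (n : ℕ) : Monotone (uniformGrid a b n) :=
  monotone_nat_of_le_succ fun i => by
    have := uniformGrid_succ_sub a b n i
    have h : 0 ≤ (b - a) / n := div_nonneg (sub_nonneg.2 hab) (Nat.cast_nonneg _)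
    linarith

section

variable {f : ℝ × ℝ → ℝ} {V e W d : ℝ → ℝ} {C : ℝ}

theorem norm_boxFourier_sub_le (h : StripControl f V e C)
    (h' : StripControl (f ∘ Prod.swap) W d C) (ξ η : ℝ) {a b c k : ℝ} (hab : a ≤ b) (hck : c ≤ k) :
    ‖boxFourier f ξ η a b c k -
      f (a, c) * (∫ s in a..b, phase ξ s) * ∫ t in c..k, phase η t‖ ≤
      ((V b - V a) + (W k - W c)) * (k - c) * (b - a) := by
  have hm := measurable_fourierIntegrand (h.measurable h') ξ η
  have hC : ∀ p, ‖fourierIntegrand f ξ η p‖ ≤ C := fun p =>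
    (norm_fourierIntegrand f ξ η p).le.trans (h.abs_apply_le p)
  have hconst : f (a, c) * (∫ s in a..b, phase ξ s) * ∫ t in c..k, phase η t =
      ∫ s in a..b, ∫ t in c..k, (f (a, c) : ℂ) * phase ξ s * phase η t := by
    simp only [intervalIntegral.integral_const_mul, intervalIntegral.integral_mul_const]
  have hcm : Measurable fun p : ℝ × ℝ => (f (a, c) : ℂ) * phase ξ p.1 * phase η p.2 :=
    (((continuous_phase ξ).measurable.comp measurable_fst).const_mul _).mul
      ((continuous_phase η).measurable.comp measurable_snd)
  have hcC : ∀ p : ℝ × ℝ, ‖(f (a, c) : ℂ) * phase ξ p.1 * phase η p.2‖ ≤ C := by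
    intro p
    simpa [norm_phase] using h.abs_apply_le (a, c)
  rw [hconst, boxFourier, ← intervalIntegral.integral_sub
    (intervalIntegrable_intervalIntegral hm hC _ _ _ _)
    (intervalIntegrable_intervalIntegral hcm hcC _ _ _ _)]
  rw [← abs_of_nonneg (sub_nonneg.2 hab)]
  refine intervalIntegral.norm_integral_le_of_norm_le_const fun s hs => ?_
  rw [← intervalIntegral.integral_sub (f := fun t => fourierIntegrand f ξ η (s, t))
    (g := fun t => (f (a, c) : ℂ) * phase ξ s * phase η t)
    (intervalIntegrable_of_measurable_of_norm_le (hm.comp measurable_prodMk_left) (fun _ => hC _) _ _)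
    (intervalIntegrable_of_measurable_of_norm_le (hcm.comp measurable_prodMk_left)
      (fun _ => hcC _) _ _)]
  rw [← abs_of_nonneg (sub_nonneg.2 hck)]
  refine intervalIntegral.norm_integral_le_of_norm_le_const fun t ht => ?_
  rw [uIoc_of_le hab] at hs
  rw [uIoc_of_le hck] at ht
  rw [fourierIntegrand_eq, ← sub_mul, ← sub_mul, norm_mul, norm_mul, norm_phase,
    norm_phase, mul_one, mul_one, ← Complex.ofReal_sub, Complex.norm_real, Real.norm_eq_abs]
  refine (h.abs_sub_le_add h' _ _).trans (add_le_add ?_ ?_)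
  · rw [abs_of_nonneg (sub_nonneg.2 (h.mono hs.1.le))]
    exact sub_le_sub_right (h.mono hs.2) _
  · rw [abs_of_nonneg (sub_nonneg.2 (h'.mono ht.1.le))]
    exact sub_le_sub_right (h'.mono ht.2) _

theorem boxFourier_eq_sum (hf : Measurable f) (hC : ∀ p, |f p| ≤ C) (ξ η : ℝ) (x y : ℕ → ℝ)
    (n m : ℕ) :
    boxFourier f ξ η (x 0) (x n) (y 0) (y m) =
      ∑ i ∈ Finset.range n, ∑ j ∈ Finset.range m,
        boxFourier f ξ η (x i) (x (i + 1)) (y j) (y (j + 1)) := by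
  have hm := measurable_fourierIntegrand hf ξ η
  have hC : ∀ p, ‖fourierIntegrand f ξ η p‖ ≤ C := fun p =>
    (norm_fourierIntegrand f ξ η p).le.trans (hC p)
  unfold boxFourier
  rw [← intervalIntegral.sum_integral_adjacent_intervals
    (fun i _ => intervalIntegrable_intervalIntegral hm hC _ _ _ _)]
  refine Finset.sum_congr rfl fun i _ => ?_
  rw [← intervalIntegral.integral_finsetSum
    (fun j _ => intervalIntegrable_intervalIntegral hm hC _ _ _ _)]
  congr 1
  ext s
  rw [intervalIntegral.sum_integral_adjacent_intervals (f := fun t => fourierIntegrand f ξ η (s, t))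
    (fun j _ => intervalIntegrable_of_measurable_of_norm_le (hm.comp measurable_prodMk_left)
      (fun _ => hC _) _ _)]

/-- The Fourier–Stieltjes sum of `f` over the grid with nodes `x` and `y`. -/
def stieltjesSum (f : ℝ × ℝ → ℝ) (x y : ℕ → ℝ) (n : ℕ) (ξ η : ℝ) : ℂ :=
  ∑ i ∈ Finset.range n, ∑ j ∈ Finset.range n,
    (mixedDiff f (x i) (x (i + 1)) (y j) (y (j + 1)) : ℂ) *
      phase ξ (x (i + 1)) * phase η (y (j + 1))

/-- Freezing `f` at the lower corner of each cell costs oscillation times area. The oscillations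
telescope to O(n) over n² cells, each of area O(1/n²), which leaves O(1/n). -/
theorem norm_boxFourier_sub_sum_le (h : StripControl f V e C)
    (h' : StripControl (f ∘ Prod.swap) W d C) (ξ η : ℝ) {a b c k : ℝ} (hab : a ≤ b) (hck : c ≤ k)
    {n : ℕ} (hn : n ≠ 0) :
    ‖boxFourier f ξ η a b c k - ∑ i ∈ Finset.range n, ∑ j ∈ Finset.range n,
      f (uniformGrid a b n i, uniformGrid c k n j) *
        (∫ s in uniformGrid a b n i..uniformGrid a b n (i + 1), phase ξ s) *
        ∫ t in uniformGrid c k n j..uniformGrid c k n (j + 1), phase η t‖ ≤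
      2 * C * (k - c) * (b - a) / n := by
  have hx := monotone_uniformGrid hab n
  have hy := monotone_uniformGrid hck n
  have hsum := boxFourier_eq_sum (h.measurable h') h.abs_apply_le ξ η (uniformGrid a b n)
    (uniformGrid c k n) n n
  simp only [uniformGrid_zero, uniformGrid_self _ _ hn] at hsum
  rw [hsum, ← Finset.sum_sub_distrib]
  simp only [← Finset.sum_sub_distrib]
  have hV := h.le b
  have hV' := h.nonneg a
  have hW := h'.le k
  have hW' := h'.nonneg c
  have hn0 : (0 : ℝ) < n := by positivity
  calc _ ≤ ∑ i ∈ Finset.range n, ∑ j ∈ Finset.range n,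
        ((V (uniformGrid a b n (i + 1)) - V (uniformGrid a b n i)) +
          (W (uniformGrid c k n (j + 1)) - W (uniformGrid c k n j))) * ((k - c) / n) *
            ((b - a) / n) := by
        refine norm_sum_le_of_le _ fun i _ => norm_sum_le_of_le _ fun j _ => ?_
        rw [← uniformGrid_succ_sub a b n i, ← uniformGrid_succ_sub c k n j]
        exact norm_boxFourier_sub_le h h' ξ η (hx i.le_succ) (hy j.le_succ)
    _ = ((V b - V a) + (W k - W c)) * (k - c) * (b - a) / n := by
        simp only [← Finset.sum_mul, Finset.sum_add_distrib]
        rw [Finset.sum_comm]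
        simp only [Finset.sum_range_sub (fun i => V (uniformGrid a b n i)),
          Finset.sum_range_sub (fun i => W (uniformGrid c k n i)), Finset.sum_const,
          Finset.card_range, nsmul_eq_mul, uniformGrid_zero, uniformGrid_self _ _ hn]
        field_simp
    _ ≤ _ := by
        gcongr
        linarith

/-- `B` bounds the variation along horizontal edges and is left free: strips use an increment of V,
growing squares need a bound that tends to zero. -/
theorem norm_mul_boxFourier_sub_stieltjesSum_le (h : StripControl f V e C)
    (h' : StripControl (f ∘ Prod.swap) W d C) {ξ η : ℝ} (hξ : ξ ≠ 0) (hη : η ≠ 0) {a b c k : ℝ} {B : ℝ → ℝ}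
    (hab : a ≤ b) (hck : c ≤ k) {n : ℕ} (hn : n ≠ 0)
    (hB : ∀ y, ∑ i ∈ Finset.range n,
      |f (uniformGrid a b n (i + 1), y) - f (uniformGrid a b n i, y)| ≤ B y) :
    ‖-(ξ * η : ℂ) * boxFourier f ξ η a b c k -
      stieltjesSum f (uniformGrid a b n) (uniformGrid c k n) n ξ η‖ ≤
      3 * (e a + e b) + (B c + B k) + |ξ * η| * (2 * C * (k - c) * (b - a) / n) := by
  set x := uniformGrid a b n with hxdef
  set y := uniformGrid c k n with hydef
  have hy : Monotone y := monotone_uniformGrid hck n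
  have hx0 : x 0 = a := uniformGrid_zero a b n
  have hxn : x n = b := uniformGrid_self a b hn
  have hy0 : y 0 = c := uniformGrid_zero c k n
  have hyn : y n = k := uniformGrid_self c k hn
  have hR := norm_boxFourier_sub_sum_le h h' ξ η hab hck hn
  rw [← hxdef, ← hydef] at hR
  set R := ∑ i ∈ Finset.range n, ∑ j ∈ Finset.range n,
      f (x i, y j) * (∫ s in x i..x (i + 1), phase ξ s) * ∫ t in y j..y (j + 1), phase η t with hRdef
  have hRsum : -(ξ * η : ℂ) * R = ∑ i ∈ Finset.range n, ∑ j ∈ Finset.range n,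
      (f (x i, y j) : ℂ) * (phase ξ (x (i + 1)) - phase ξ (x i)) *
        (phase η (y (j + 1)) - phase η (y j)) := by
    rw [hRdef, Finset.mul_sum]
    refine Finset.sum_congr rfl fun i _ => ?_
    rw [Finset.mul_sum]
    refine Finset.sum_congr rfl fun j _ => ?_
    rw [← integral_phase hξ, ← integral_phase hη]
    -- The two factors -iξ and -iη multiply to -ξη.
    linear_combination (-(ξ * η : ℂ) * (f (x i, y j) * (∫ s in x i..x (i + 1), phase ξ s) *
      ∫ t in y j..y (j + 1), phase η t)) * Complex.I_sq
  have hparts := norm_sum_mul_sub_mul_sub_le n n (fun i j => (f (x i, y j) : ℂ))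
    (fun i => phase ξ (x i)) (fun j => phase η (y j)) (fun _ => (norm_phase _ _).le)
    (fun _ => (norm_phase _ _).le)
  simp only [← Complex.ofReal_sub, ← Complex.ofReal_add, Complex.norm_real, Real.norm_eq_abs,
    hx0, hxn, hy0, hyn] at hparts
  have hS : stieltjesSum f x y n ξ η = ∑ i ∈ Finset.range n, ∑ j ∈ Finset.range n,
      ((f (x (i + 1), y (j + 1)) - f (x i, y (j + 1)) - f (x (i + 1), y j) + f (x i, y j) : ℝ) : ℂ) *
        phase ξ (x (i + 1)) * phase η (y (j + 1)) := rfl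
  rw [← hS] at hparts
  have hmul : ‖-(ξ * η : ℂ) * (boxFourier f ξ η a b c k - R)‖ ≤
      |ξ * η| * (2 * C * (k - c) * (b - a) / n) := by
    rw [norm_mul, norm_neg, ← Complex.ofReal_mul, Complex.norm_real, Real.norm_eq_abs]
    exact mul_le_mul_of_nonneg_left hR (abs_nonneg _)
  calc _ = ‖(-(ξ * η : ℂ) * R - stieltjesSum f x y n ξ η) +
        -(ξ * η : ℂ) * (boxFourier f ξ η a b c k - R)‖ := by congr 1; ring
    _ ≤ _ := by
      refine (norm_add_le _ _).trans (add_le_add ?_ hmul)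
      rw [hRsum]
      refine hparts.trans ?_
      -- The four corner values give 2(e a + e b) and the vertical edges one more e a + e b, hence
      -- the factor 3.
      linarith [h.abs_le a c, h.abs_le a k, h.abs_le b c, h.abs_le b k, hB c, hB k,
        h.edge a n y hy, h.edge b n y hy]

theorem norm_stieltjesSum_le (h : StripControl f V e C) {x y : ℕ → ℝ} (hx : Monotone x)
    (hy : Monotone y) (n : ℕ) (ξ η : ℝ) :
    ‖stieltjesSum f x y n ξ η‖ ≤ V (x n) - V (x 0) := by
  rw [← Finset.sum_range_sub (fun i => V (x i))]
  refine norm_sum_le_of_le _ fun i _ => ?_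
  refine (norm_sum_le _ _).trans (le_trans (le_of_eq ?_) (h.mixed _ _ (hx i.le_succ) n y hy))
  refine Finset.sum_congr rfl fun j _ => ?_
  rw [norm_mul, norm_mul, norm_phase, norm_phase, mul_one, mul_one, Complex.norm_real,
    Real.norm_eq_abs]

theorem StripControl.sum_abs_sub_le (h : StripControl f V e C) {x : ℕ → ℝ} (hx : Monotone x)
    (n : ℕ) (y : ℝ) :
    ∑ i ∈ Finset.range n, |f (x (i + 1), y) - f (x i, y)| ≤ V (x n) - V (x 0) := by
  rw [← Finset.sum_range_sub (fun i => V (x i))]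
  exact Finset.sum_le_sum fun i _ => h.sub_le _ _ _ (hx i.le_succ)

theorem tendsto_const_div_add_one (D : ℝ) : Tendsto (fun n : ℕ => D / (n + 1 : ℕ)) atTop (𝓝 0) :=
  (tendsto_const_div_atTop_nhds_zero_nat D).comp (tendsto_add_atTop_nat 1)

/-- Integrals over vertical strips are small far away from the origin. -/
theorem norm_mul_boxFourier_le (h : StripControl f V e C)
    (h' : StripControl (f ∘ Prod.swap) W d C) {ξ η : ℝ} (hξ : ξ ≠ 0) (hη : η ≠ 0) {a b c k : ℝ}
    (hab : a ≤ b) (hck : c ≤ k) :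
    |ξ * η| * ‖boxFourier f ξ η a b c k‖ ≤ 3 * (e a + e b) + 3 * (V b - V a) := by
  have hlim : Tendsto (fun n : ℕ => 3 * (e a + e b) + 3 * (V b - V a) +
      |ξ * η| * (2 * C * (k - c) * (b - a) / (n + 1 : ℕ))) atTop
      (𝓝 (3 * (e a + e b) + 3 * (V b - V a) + |ξ * η| * 0)) :=
    ((tendsto_const_div_add_one _).const_mul _).const_add _
  rw [mul_zero, add_zero] at hlim
  refine ge_of_tendsto' hlim fun n => ?_
  have hx := monotone_uniformGrid hab (n + 1)
  have hB := h.sum_abs_sub_le hx (n + 1)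
  have hS := norm_stieltjesSum_le h hx (monotone_uniformGrid hck (n + 1)) (n + 1) ξ η
  rw [uniformGrid_self _ _ n.succ_ne_zero, uniformGrid_zero] at hB hS
  -- Both horizontal edges have variation at most V b - V a, as does the Stieltjes sum, hence 3(V b
  -- - V a), independently of `c` and `k`.
  have key := norm_mul_boxFourier_sub_stieltjesSum_le h h' hξ hη hab hck n.succ_ne_zero
    (B := fun _ => V b - V a) hB
  have h3 := norm_le_norm_sub_add (-(ξ * η : ℂ) * boxFourier f ξ η a b c k)
    (stieltjesSum f (uniformGrid a b (n + 1)) (uniformGrid c k (n + 1)) (n + 1) ξ η)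
  rw [norm_mul, norm_neg, ← Complex.ofReal_mul, Complex.norm_real, Real.norm_eq_abs] at h3
  rw [Complex.ofReal_mul] at h3
  simp only [Nat.succ_eq_add_one] at key
  linarith

end

/-! ### Kurzweil–Henstock integrals and existence of the transform -/

theorem integrableOn_of_measurable_of_norm_le {G : ℝ × ℝ → ℂ} {C : ℝ} (hG : Measurable G)
    (hC : ∀ p, ‖G p‖ ≤ C) {s : Set (ℝ × ℝ)} (hs : Bornology.IsBounded s) :
    IntegrableOn G s :=
  IntegrableOn.of_bound hs.measure_lt_top hG.aestronglyMeasurable C (ae_of_all _ hC)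

theorem hasIntegral_planeBox {G : ℝ × ℝ → ℂ} {C : ℝ} (hG : Measurable G)
    (hC : ∀ p, ‖G p‖ ≤ C) {a b c d : ℝ} (hab : a < b) (hcd : c < d) :
    BoxIntegral.HasIntegral (planeBox a b c d hab hcd) BoxIntegral.IntegrationParams.Henstock
      (fun p : Fin 2 → ℝ => G (p 0, p 1)) BoxIntegral.BoxAdditiveMap.volume
      (∫ s in a..b, ∫ t in c..d, G (s, t)) := by
  have hmp := volume_preserving_finTwoArrow ℝ
  have hset : ((planeBox a b c d hab hcd : BoxIntegral.Box (Fin 2)) : Set (Fin 2 → ℝ)) =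
      MeasurableEquiv.finTwoArrow ⁻¹' (Ioc a b ×ˢ Ioc c d) := by
    ext p
    simp [planeBox, BoxIntegral.Box.mem_def, Fin.forall_fin_two, MeasurableEquiv.finTwoArrow]
  have hint : IntegrableOn G (Ioc a b ×ˢ Ioc c d) :=
    integrableOn_of_measurable_of_norm_le hG hC
      ((Metric.isBounded_Ioc a b).prod (Metric.isBounded_Ioc c d))
  have hint' : IntegrableOn (fun p : Fin 2 → ℝ => G (p 0, p 1))
      (planeBox a b c d hab hcd : Set (Fin 2 → ℝ)) := by
    rw [hset]
    exact (hmp.integrableOn_comp_preimage MeasurableEquiv.finTwoArrow.measurableEmbedding).2 hint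
  have hval : ∫ p in (planeBox a b c d hab hcd : Set (Fin 2 → ℝ)), G (p 0, p 1) =
      ∫ s in a..b, ∫ t in c..d, G (s, t) := by
    rw [hset]
    refine (hmp.setIntegral_preimage_emb MeasurableEquiv.finTwoArrow.measurableEmbedding G _).trans ?_
    rw [Measure.volume_eq_prod, setIntegral_prod _ hint, intervalIntegral.integral_of_le hab.le]
    simp only [intervalIntegral.integral_of_le hcd.le]
  rw [← hval]
  -- `rfl` verifies that the Henstock parameters are not of Riemann type, so Lebesgue integrability
  -- suffices.
  exact hint'.hasBoxIntegral _ rfl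

section

variable {f : ℝ × ℝ → ℝ} {V e W d : ℝ → ℝ} {C : ℝ}

theorem StripControl.khLoc (h : StripControl f V e C) (h' : StripControl (f ∘ Prod.swap) W d C)
    (ξ η : ℝ) : KHLoc (fourierIntegrand f ξ η) := fun _ _ _ _ hab hcd =>
  (hasIntegral_planeBox (measurable_fourierIntegrand (h.measurable h') ξ η)
    (fun p => (norm_fourierIntegrand f ξ η p).le.trans (h.abs_apply_le p)) hab hcd).integrable

theorem StripControl.khIntegral_eq (h : StripControl f V e C)
    (h' : StripControl (f ∘ Prod.swap) W d C) (ξ η : ℝ) {a b c k : ℝ} (hab : a < b) (hck : c < k) :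
    khIntegral (fourierIntegrand f ξ η) a b c k = boxFourier f ξ η a b c k := by
  rw [khIntegral, dif_pos ⟨hab, hck⟩]
  exact (hasIntegral_planeBox (measurable_fourierIntegrand (h.measurable h') ξ η)
    (fun p => (norm_fourierIntegrand f ξ η p).le.trans (h.abs_apply_le p)) hab hck).integral_eq

theorem boxFourier_swap (hf : Measurable f) (hC : ∀ p, |f p| ≤ C) (ξ η a b c k : ℝ) :
    boxFourier (f ∘ Prod.swap) η ξ c k a b = boxFourier f ξ η a b c k := by
  unfold boxFourier
  rw [intervalIntegral_intervalIntegral_swap]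
  · refine intervalIntegral.integral_congr fun s _ => intervalIntegral.integral_congr fun t _ => ?_
    simp only [fourierIntegrand, Function.comp, Prod.swap]
    rw [add_comm]
  · exact integrableOn_of_measurable_of_norm_le
      (measurable_fourierIntegrand (hf.comp measurable_swap) η ξ)
      (fun p => (norm_fourierIntegrand _ η ξ p).le.trans (hC p.swap))
      ((Metric.isBounded_Ioc _ _).prod (Metric.isBounded_Ioc _ _))

theorem boxFourier_symm_left (f : ℝ × ℝ → ℝ) (ξ η a b c k : ℝ) :
    boxFourier f ξ η b a c k = -boxFourier f ξ η a b c k :=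
  intervalIntegral.integral_symm a b

theorem boxFourier_symm_right (f : ℝ × ℝ → ℝ) (ξ η a b c k : ℝ) :
    boxFourier f ξ η a b k c = -boxFourier f ξ η a b c k := by
  unfold boxFourier
  simp only [intervalIntegral.integral_symm c k, intervalIntegral.integral_neg]

theorem boxFourier_add_left (hf : Measurable f) (hC : ∀ p, |f p| ≤ C) (ξ η a b z c k : ℝ) :
    boxFourier f ξ η a b c k + boxFourier f ξ η b z c k = boxFourier f ξ η a z c k := by
  have hm := measurable_fourierIntegrand hf ξ η
  have hC : ∀ p, ‖fourierIntegrand f ξ η p‖ ≤ C := fun p =>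
    (norm_fourierIntegrand f ξ η p).le.trans (hC p)
  exact intervalIntegral.integral_add_adjacent_intervals
    (intervalIntegrable_intervalIntegral hm hC _ _ _ _)
    (intervalIntegrable_intervalIntegral hm hC _ _ _ _)

theorem boxFourier_add_right (hf : Measurable f) (hC : ∀ p, |f p| ≤ C) (ξ η a b c k z : ℝ) :
    boxFourier f ξ η a b c k + boxFourier f ξ η a b k z = boxFourier f ξ η a b c z := by
  simp only [← boxFourier_swap hf hC]
  exact boxFourier_add_left (hf.comp measurable_swap) (fun p => hC p.swap) _ _ _ _ _ _ _

/-- A bound for the Fourier integral of `f` over the vertical strip between `a` and `b`. -/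
def stripBound (V e : ℝ → ℝ) (a b : ℝ) : ℝ := 3 * (e a + e b) + 3 * |V b - V a|

theorem norm_mul_boxFourier_le_stripBound (h : StripControl f V e C)
    (h' : StripControl (f ∘ Prod.swap) W d C) {ξ η : ℝ} (hξ : ξ ≠ 0) (hη : η ≠ 0) (a b c k : ℝ) :
    |ξ * η| * ‖boxFourier f ξ η a b c k‖ ≤ stripBound V e a b := by
  wlog hck : c ≤ k generalizing c k
  · rw [boxFourier_symm_right, norm_neg]
    exact this k c (le_of_not_ge hck)
  wlog hab : a ≤ b generalizing a b
  · rw [boxFourier_symm_left, norm_neg, stripBound, add_comm (e a), abs_sub_comm]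
    exact this b a (le_of_not_ge hab)
  refine (norm_mul_boxFourier_le h h' hξ hη hab hck).trans ?_
  unfold stripBound
  gcongr
  exact le_abs_self _

theorem StripControl.tendsto_stripBound (h : StripControl f V e C) {ι : Type*} {l : Filter ι}
    {g g' : ι → ℝ} (hg : (Tendsto g l atTop ∧ Tendsto g' l atTop) ∨
      (Tendsto g l atBot ∧ Tendsto g' l atBot)) :
    Tendsto (fun i => stripBound V e (g i) (g' i)) l (𝓝 0) := by
  have key : ∀ L : Filter ℝ, ∀ p, Tendsto V L (𝓝 p) → Tendsto e L (𝓝 0) → Tendsto g l L →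
      Tendsto g' l L → Tendsto (fun i => stripBound V e (g i) (g' i)) l (𝓝 0) := by
    intro L p hV he hg hg'
    have := (((he.comp hg).add (he.comp hg')).const_mul 3).add
      (((hV.comp hg').sub (hV.comp hg)).abs.const_mul 3)
    simpa [stripBound] using this
  rcases hg with ⟨hg, hg'⟩ | ⟨hg, hg'⟩
  · exact key _ _ (tendsto_atTop_ciSup h.mono ⟨C, by rintro _ ⟨x, rfl⟩; exact h.le x⟩)
      h.tendsto_atTop hg hg'
  · exact key _ _ (tendsto_atBot_ciInf h.mono ⟨0, by rintro _ ⟨x, rfl⟩; exact h.nonneg x⟩)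
      h.tendsto_atBot hg hg'

/-- Cauchy criterion: two large boxes differ by four strips far from the origin, whose integrals are
small uniformly in their length. -/
theorem exists_tendsto_boxFourier (h : StripControl f V e C)
    (h' : StripControl (f ∘ Prod.swap) W d C) {ξ η : ℝ} (hξ : ξ ≠ 0) (hη : η ≠ 0) :
    ∃ z, Tendsto (fun q : (ℝ × ℝ) × (ℝ × ℝ) => boxFourier f ξ η q.1.1 q.1.2 q.2.1 q.2.2)
      ((atBot ×ˢ atTop) ×ˢ (atBot ×ˢ atTop)) (𝓝 z) := by
  rw [← cauchy_map_iff_exists_tendsto, cauchy_map_iff]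
  refine ⟨inferInstance, ?_⟩
  rw [tendsto_uniformity_iff_dist_tendsto_zero]
  set l : Filter ((ℝ × ℝ) × (ℝ × ℝ)) := (atBot ×ˢ atTop) ×ˢ (atBot ×ˢ atTop) with hl
  have hf := h.measurable h'
  have hC := h.abs_apply_le
  have hpos : 0 < |ξ * η| := abs_pos.2 (mul_ne_zero hξ hη)
  have t1 : Tendsto (fun q : (ℝ × ℝ) × (ℝ × ℝ) => q.1.1) l atBot := tendsto_fst.comp tendsto_fst
  have t2 : Tendsto (fun q : (ℝ × ℝ) × (ℝ × ℝ) => q.1.2) l atTop := tendsto_snd.comp tendsto_fst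
  have t3 : Tendsto (fun q : (ℝ × ℝ) × (ℝ × ℝ) => q.2.1) l atBot := tendsto_fst.comp tendsto_snd
  have t4 : Tendsto (fun q : (ℝ × ℝ) × (ℝ × ℝ) => q.2.2) l atTop := tendsto_snd.comp tendsto_snd
  have hlim := ((((h.tendsto_stripBound (l := l ×ˢ l)
    (Or.inr ⟨t1.comp tendsto_fst, t1.comp tendsto_snd⟩)).add
    (h.tendsto_stripBound (Or.inl ⟨t2.comp tendsto_snd, t2.comp tendsto_fst⟩))).add
    (h'.tendsto_stripBound (Or.inr ⟨t3.comp tendsto_fst, t3.comp tendsto_snd⟩))).add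
    (h'.tendsto_stripBound (Or.inl ⟨t4.comp tendsto_snd, t4.comp tendsto_fst⟩))).div_const |ξ * η|
  simp only [add_zero, zero_div] at hlim
  refine squeeze_zero (fun _ => dist_nonneg) (fun p => ?_) hlim
  obtain ⟨⟨⟨a, b⟩, c, k⟩, ⟨⟨a', b'⟩, c', k'⟩⟩ := p
  rw [dist_eq_norm, le_div_iff₀' hpos]
  simp only [Function.comp]
  -- The first variable is changed by two vertical strips, then the second by two horizontal ones;
  -- oriented integrals avoid any ordering of the endpoints.
  have hdec : boxFourier f ξ η a b c k - boxFourier f ξ η a' b' c' k' =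
      boxFourier f ξ η a a' c k + boxFourier f ξ η b' b c k +
        boxFourier f ξ η a' b' c c' + boxFourier f ξ η a' b' k' k := by
    rw [← boxFourier_add_left hf hC ξ η a a' b c k, ← boxFourier_add_left hf hC ξ η a' b' b c k,
      ← boxFourier_add_right hf hC ξ η a' b' c c' k, ← boxFourier_add_right hf hC ξ η a' b' c' k' k]
    ring
  have hswap : ∀ x z s t, |ξ * η| * ‖boxFourier f ξ η x z s t‖ ≤ stripBound W d s t := by
    intro x z s t
    rw [← boxFourier_swap hf hC, mul_comm ξ]
    exact norm_mul_boxFourier_le_stripBound h' h hη hξ s t x z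
  have hle := norm_mul_boxFourier_le_stripBound h h' hξ hη
  rw [hdec]
  calc _ ≤ |ξ * η| * (‖boxFourier f ξ η a a' c k‖ + ‖boxFourier f ξ η b' b c k‖ +
        ‖boxFourier f ξ η a' b' c c'‖ + ‖boxFourier f ξ η a' b' k' k‖) := by
        gcongr
        exact norm_add₄_le
    _ ≤ _ := by
        simp only [mul_add]
        exact add_le_add (add_le_add (add_le_add (hle _ _ _ _) (hle _ _ _ _)) (hswap _ _ _ _))
          (hswap _ _ _ _)

theorem StripControl.hasKPFourier (h : StripControl f V e C)
    (h' : StripControl (f ∘ Prod.swap) W d C) {ξ η : ℝ} (hξ : ξ ≠ 0) (hη : η ≠ 0) :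
    HasKPFourier f ξ η (kpFourier f ξ η) := by
  obtain ⟨z, hz⟩ := exists_tendsto_boxFourier h h' hξ hη
  -- `khIntegral` is zero by default on degenerate boxes, so it agrees with `boxFourier` only
  -- eventually.
  have hev : ∀ᶠ p : ℝ × ℝ in atBot ×ˢ atTop, p.1 < p.2 :=
    (((eventually_lt_atBot 0).prod_inl atTop).and ((eventually_gt_atTop 0).prod_inr atBot)).mono
      fun p hp => hp.1.trans hp.2
  have hz' : HasKPFourier f ξ η z := by
    refine ⟨h.khLoc h' ξ η, hz.congr' ?_⟩
    filter_upwards [(hev.prod_inl (atBot ×ˢ atTop)).and (hev.prod_inr (atBot ×ˢ atTop))] with q hq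
    exact (h.khIntegral_eq h' ξ η hq.1 hq.2).symm
  rwa [hz'.kpFourier_eq]

/-- The Fourier–Stieltjes sums of `f` over the uniform partition of `[-N-1, N+1]²` into
`(N+1)⁶` squares. -/
def squareStieltjesSum (f : ℝ × ℝ → ℝ) (N : ℕ) (ξ η : ℝ) : ℂ :=
  stieltjesSum f (uniformGrid (-(N + 1 : ℕ)) (N + 1 : ℕ) ((N + 1) ^ 3))
    (uniformGrid (-(N + 1 : ℕ)) (N + 1 : ℕ) ((N + 1) ^ 3)) ((N + 1) ^ 3) ξ η

theorem tendsto_squareStieltjesSum (h : StripControl f V e C)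
    (h' : StripControl (f ∘ Prod.swap) W d C) {ξ η : ℝ} (hξ : ξ ≠ 0) (hη : η ≠ 0) :
    Tendsto (fun N => squareStieltjesSum f N ξ η) atTop (𝓝 (-(ξ * η : ℂ) * kpFourier f ξ η)) := by
  have hN : Tendsto (fun N : ℕ => ((N + 1 : ℕ) : ℝ)) atTop atTop :=
    tendsto_natCast_atTop_atTop.comp (tendsto_add_atTop_nat 1)
  have hN' : Tendsto (fun N : ℕ => -((N + 1 : ℕ) : ℝ)) atTop atBot :=
    tendsto_neg_atTop_atBot.comp hN
  have hkp := (h.hasKPFourier h' hξ hη).2.comp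
    ((hN'.prodMk hN).prodMk (hN'.prodMk hN))
  have hle : ∀ N : ℕ, -((N + 1 : ℕ) : ℝ) < (N + 1 : ℕ) := fun N => by
    have : (0 : ℝ) < (N + 1 : ℕ) := by positivity
    linarith
  have hbox := (hkp.congr fun N => h.khIntegral_eq h' ξ η (hle N) (hle N)).const_mul (-(ξ * η : ℂ))
  have herr : Tendsto (fun N : ℕ => 3 * (e (-(N + 1 : ℕ)) + e (N + 1 : ℕ)) +
      (d (-(N + 1 : ℕ)) + d (N + 1 : ℕ)) + |ξ * η| * (8 * C / (N + 1 : ℕ))) atTop (𝓝 0) := by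
    have := ((((h.tendsto_atBot.comp hN').add (h.tendsto_atTop.comp hN)).const_mul 3).add
      ((h'.tendsto_atBot.comp hN').add (h'.tendsto_atTop.comp hN))).add
      ((tendsto_const_div_add_one (8 * C)).const_mul |ξ * η|)
    simpa using this
  have hdiff := squeeze_zero_norm (fun N => ?_) herr (f := fun N : ℕ =>
    -(ξ * η : ℂ) * boxFourier f ξ η (-(N + 1 : ℕ)) (N + 1 : ℕ) (-(N + 1 : ℕ)) (N + 1 : ℕ) -
      squareStieltjesSum f N ξ η)
  · have := hbox.sub hdiff
    simpa using this
  · have hx := monotone_uniformGrid (hle N).le ((N + 1) ^ 3)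
    -- Horizontal edges are bounded by `d`, which decays. With (N+1)³ intervals per side the
    -- freezing error is 2C(2(N+1))²/(N+1)³ = 8C/(N+1).
    refine (norm_mul_boxFourier_sub_stieltjesSum_le h h' hξ hη (hle N).le (hle N).le
      (pow_ne_zero 3 N.succ_ne_zero) (fun y => h'.edge y ((N + 1) ^ 3) _ hx)).trans (le_of_eq ?_)
    congr 2
    have : ((N + 1 : ℕ) : ℝ) ≠ 0 := by positivity
    push_cast at this ⊢
    field_simp
    ring

end

/-! ### Truncated sine integrals and condition (L) -/

/-- The truncated sine integral `∫_α^β sin(τ ξ) / ξ dξ`. -/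
def truncSine (τ α β : ℝ) : ℝ := ∫ ξ in α..β, Real.sin (τ * ξ) / ξ

theorem abs_truncSine_le_mul_sub (τ : ℝ) {α β : ℝ} (hα : 0 < α) (hαβ : α ≤ β) :
    |truncSine τ α β| ≤ |τ| * (β - α) := by
  rw [← abs_of_nonneg (sub_nonneg.2 hαβ), ← Real.norm_eq_abs (truncSine τ α β)]
  refine intervalIntegral.norm_integral_le_of_norm_le_const fun ξ hξ => ?_
  rw [uIoc_of_le hαβ] at hξ
  have hξ0 : 0 < ξ := hα.trans hξ.1
  rw [Real.norm_eq_abs, abs_div, div_le_iff₀ (abs_pos.2 hξ0.ne'), ← abs_mul]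
  exact Real.abs_sin_le_abs

theorem intervalIntegrable_sin_div (τ : ℝ) {α β : ℝ} (hα : 0 < α) (hβ : 0 < β) :
    IntervalIntegrable (fun ξ => Real.sin (τ * ξ) / ξ) volume α β := by
  refine ContinuousOn.intervalIntegrable fun ξ hξ => ContinuousAt.continuousWithinAt ?_
  have hξ0 : ξ ≠ 0 := ((lt_min hα hβ).trans_le hξ.1).ne'
  fun_prop (disch := assumption)

theorem truncSine_add (τ : ℝ) {α β γ : ℝ} (hα : 0 < α) (hβ : 0 < β) (hγ : 0 < γ) :
    truncSine τ α β + truncSine τ β γ = truncSine τ α γ :=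
  intervalIntegral.integral_add_adjacent_intervals (intervalIntegrable_sin_div τ hα hβ)
    (intervalIntegrable_sin_div τ hβ hγ)

/-- One integration by parts: the boundary terms and the remainder, whose integrand is at most
1/(|τ|ξ²), together give 2/(|τ|α). -/
theorem abs_truncSine_le_two_div {τ α β : ℝ} (hτ : τ ≠ 0) (hα : 0 < α) (hαβ : α ≤ β) :
    |truncSine τ α β| ≤ 2 / (|τ| * α) := by
  have hβ : 0 < β := hα.trans_le hαβ
  have hpos : ∀ ξ ∈ uIcc α β, ξ ≠ 0 := fun ξ hξ => ((lt_min hα hβ).trans_le hξ.1).ne'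
  have hcont : IntervalIntegrable (fun ξ => Real.cos (τ * ξ) / (τ * ξ ^ 2)) volume α β := by
    refine ContinuousOn.intervalIntegrable fun ξ hξ => ContinuousAt.continuousWithinAt ?_
    have hξ0 : τ * ξ ^ 2 ≠ 0 := mul_ne_zero hτ (pow_ne_zero 2 (hpos ξ hξ))
    fun_prop (disch := assumption)
  have hsq : IntervalIntegrable (fun ξ : ℝ => 1 / (|τ| * ξ ^ 2)) volume α β := by
    refine ContinuousOn.intervalIntegrable fun ξ hξ => ContinuousAt.continuousWithinAt ?_
    have hξ0 : |τ| * ξ ^ 2 ≠ 0 := mul_ne_zero (abs_ne_zero.2 hτ) (pow_ne_zero 2 (hpos ξ hξ))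
    fun_prop (disch := assumption)
  have hparts : truncSine τ α β + ∫ ξ in α..β, Real.cos (τ * ξ) / (τ * ξ ^ 2) =
      -Real.cos (τ * β) / (τ * β) - -Real.cos (τ * α) / (τ * α) := by
    rw [truncSine, ← intervalIntegral.integral_add (intervalIntegrable_sin_div τ hα hβ) hcont]
    refine intervalIntegral.integral_eq_sub_of_hasDerivAt
      (f := fun ξ => -Real.cos (τ * ξ) / (τ * ξ)) (fun ξ hξ => ?_)
      ((intervalIntegrable_sin_div τ hα hβ).add hcont)
    have hξ0 := hpos ξ hξ
    have hl : HasDerivAt (fun ξ : ℝ => τ * ξ) τ ξ := by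
      simpa using (hasDerivAt_id ξ).const_mul τ
    refine (hl.cos.neg.div hl (mul_ne_zero hτ hξ0)).congr_deriv ?_
    field_simp
    simp
  have hrem : |∫ ξ in α..β, Real.cos (τ * ξ) / (τ * ξ ^ 2)| ≤ 1 / (|τ| * α) - 1 / (|τ| * β) := by
    have hint : ∫ ξ in α..β, 1 / (|τ| * ξ ^ 2) = 1 / (|τ| * α) - 1 / (|τ| * β) := by
      rw [intervalIntegral.integral_eq_sub_of_hasDerivAt (f := fun ξ => -(1 / (|τ| * ξ)))
        (fun ξ hξ => ?_) hsq]
      · ring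
      · have hξ0 := hpos ξ hξ
        have hτ' := abs_ne_zero.2 hτ
        have hl : HasDerivAt (fun ξ : ℝ => |τ| * ξ) |τ| ξ := by
          simpa using (hasDerivAt_id ξ).const_mul |τ|
        simp only [one_div]
        refine (hl.inv (mul_ne_zero hτ' hξ0)).neg.congr_deriv ?_
        field_simp
    rw [← hint, ← Real.norm_eq_abs]
    refine intervalIntegral.norm_integral_le_of_norm_le hαβ (ae_of_all _ fun ξ hξ => ?_) hsq
    rw [Real.norm_eq_abs, abs_div, abs_mul, abs_of_nonneg (sq_nonneg ξ)]
    gcongr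
    exact Real.abs_cos_le_one _
  have hend : ∀ ξ, 0 < ξ → |-Real.cos (τ * ξ) / (τ * ξ)| ≤ 1 / (|τ| * ξ) := fun ξ hξ => by
    rw [abs_div, abs_neg, abs_mul, abs_of_pos hξ]
    gcongr
    exact Real.abs_cos_le_one _
  have h1 := abs_le.1 (hend α hα)
  have h2 := abs_le.1 (hend β hβ)
  have h3 := abs_le.1 hrem
  have h4 : 2 / (|τ| * α) = 2 * (1 / (|τ| * α)) := by ring
  rw [h4, abs_le]
  constructor <;> linarith

/-- A bound for the truncated sine integrals with lower end `p` and upper end at most `q`. -/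
def sineBound (τ p q : ℝ) : ℝ :=
  if |τ| * q ≤ 1 then |τ| * (q - p) else if 1 ≤ |τ| * p then 2 / (|τ| * p) else 3

theorem abs_truncSine_le_sineBound (τ : ℝ) {p q s : ℝ} (hp : 0 < p) (hps : p ≤ s) (hsq : s ≤ q) :
    |truncSine τ p s| ≤ sineBound τ p q := by
  unfold sineBound
  split_ifs with h1 h2
  · refine (abs_truncSine_le_mul_sub τ hp hps).trans ?_
    gcongr
  · have hτ : τ ≠ 0 := by rintro rfl; simp at h1
    exact abs_truncSine_le_two_div hτ hp hps
  · have hτ : τ ≠ 0 := by rintro rfl; simp at h1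
    have hτ' : 0 < |τ| := abs_pos.2 hτ
    push Not at h1 h2
    have hpm : p < |τ|⁻¹ := by rwa [lt_inv_comm₀ hp hτ', ← mul_one (p⁻¹), ← div_eq_inv_mul,
      lt_div_iff₀ hp]
    -- In the straddling case the integral is split at 1/|τ|: the lower part is at most 1 and the
    -- upper part at most 2.
    have hm : |truncSine τ p (min s |τ|⁻¹)| ≤ 1 := by
      refine (abs_truncSine_le_mul_sub τ hp (le_min hps hpm.le)).trans ?_
      calc |τ| * (min s |τ|⁻¹ - p) ≤ |τ| * |τ|⁻¹ := by
            gcongr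
            linarith [min_le_right s |τ|⁻¹]
        _ = 1 := mul_inv_cancel₀ hτ'.ne'
    rcases le_total s |τ|⁻¹ with hs | hs
    · rw [min_eq_left hs] at hm
      linarith
    · rw [min_eq_right hs] at hm
      have h3 := abs_truncSine_le_two_div hτ (inv_pos.2 hτ') hs
      rw [mul_inv_cancel₀ hτ'.ne', div_one] at h3
      rw [← truncSine_add τ hp (inv_pos.2 hτ') (hp.trans_le hps)]
      linarith [abs_add_le (truncSine τ p |τ|⁻¹) (truncSine τ |τ|⁻¹ s)]

theorem LacunaryWith.sum_inv_le {u : ℕ → ℝ} {A : ℝ} (hu : LacunaryWith u A) {m : ℕ} (hm : 1 ≤ m)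
    (k : ℕ) : ∑ j ∈ Finset.range k, 1 / u (m + j) ≤ A / u m := by
  have hpos := hu.pos m hm
  rw [le_div_iff₀' hpos]
  refine le_trans ?_ (hu.le m hm)
  gcongr
  refine Summable.sum_le_tsum _ (fun j _ => ?_) ?_
  · exact (one_div_pos.2 (hu.pos _ (hm.trans (Nat.le_add_right _ _)))).le
  · obtain ⟨m', rfl⟩ := Nat.exists_eq_add_of_le hm
    have := (summable_nat_add_iff m').2 hu.summable
    refine this.congr fun j => ?_
    congr 2
    ring

/-- Terms with |τ|u_m < 1 are skipped by induction; from the first remaining index, (L) bounds the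
sum by 2A/(|τ|u_m) ≤ 2A. -/
theorem LacunaryWith.sum_two_div_le {u : ℕ → ℝ} {A : ℝ} (hu : LacunaryWith u A) (τ : ℝ) (k m : ℕ)
    (hm : 1 ≤ m) :
    ∑ j ∈ Finset.range k, (if 1 ≤ |τ| * u (m + j) then 2 / (|τ| * u (m + j)) else 0) ≤ 2 * A := by
  have hA := hu.one_lt
  induction k generalizing m with
  | zero => simp; linarith
  | succ k ih =>
    have hum := hu.pos m hm
    by_cases h : 1 ≤ |τ| * u m
    · have hτ : 0 < |τ| := by
        by_contra h0
        have := le_antisymm (not_lt.1 h0) (abs_nonneg τ)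
        rw [this, zero_mul] at h
        linarith
      calc _ ≤ ∑ j ∈ Finset.range (k + 1), 2 / |τ| * (1 / u (m + j)) := by
            refine Finset.sum_le_sum fun j _ => ?_
            have := hu.pos (m + j) (hm.trans (Nat.le_add_right _ _))
            split_ifs
            · exact le_of_eq (by field_simp)
            · positivity
        _ ≤ 2 / |τ| * (A / u m) := by
            rw [← Finset.mul_sum]
            exact mul_le_mul_of_nonneg_left (hu.sum_inv_le hm _) (by positivity)
        _ = 2 * A / (|τ| * u m) := by field_simp
        _ ≤ 2 * A := div_le_self (by linarith) h
    · rw [Finset.sum_range_succ', add_zero, if_neg h, add_zero]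
      simpa only [add_assoc, add_comm 1] using ih (m + 1) (by omega)

theorem LacunaryWith.sum_sineBound_le {u : ℕ → ℝ} {A : ℝ} (hu : LacunaryWith u A) (τ : ℝ) (N : ℕ) :
    ∑ i ∈ Finset.range N, sineBound τ (u (1 + i)) (u (1 + i + 1)) ≤ 3 * A + 4 := by
  have hτ := abs_nonneg τ
  -- Induction with the potential min(|τ|u, 1) + 3·[1 < |τ|u]: its growth pays for the blocks below
  -- 1/|τ| and for the single straddling block.
  have key : ∑ i ∈ Finset.range N, sineBound τ (u (1 + i)) (u (1 + i + 1)) ≤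
      (min (|τ| * u (1 + N)) 1 + if 1 < |τ| * u (1 + N) then 3 else 0) +
      ∑ j ∈ Finset.range N, (if 1 ≤ |τ| * u (1 + j) then 2 / (|τ| * u (1 + j)) else 0) := by
    induction N with
    | zero =>
      have := mul_nonneg hτ (hu.pos 1 le_rfl).le
      simp only [Finset.range_zero, Finset.sum_empty, add_zero]
      split_ifs <;> positivity
    | succ N ih =>
      rw [Finset.sum_range_succ, Finset.sum_range_succ, ← add_assoc 1 N 1]
      have hmono : |τ| * u (1 + N) ≤ |τ| * u (1 + N + 1) :=
        mul_le_mul_of_nonneg_left (hu.mono _ (by omega)) hτ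
      have hstep : min (|τ| * u (1 + N)) 1 + (if 1 < |τ| * u (1 + N) then 3 else 0) +
          sineBound τ (u (1 + N)) (u (1 + N + 1)) ≤
          min (|τ| * u (1 + N + 1)) 1 + (if 1 < |τ| * u (1 + N + 1) then 3 else 0) +
          (if 1 ≤ |τ| * u (1 + N) then 2 / (|τ| * u (1 + N)) else 0) := by
        unfold sineBound
        by_cases h1 : |τ| * u (1 + N + 1) ≤ 1
        · have h2 := hmono.trans h1
          rw [if_pos h1, if_neg (not_lt.2 h1), if_neg (not_lt.2 h2), min_eq_left h1, min_eq_left h2]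
          have : 0 ≤ if 1 ≤ |τ| * u (1 + N) then 2 / (|τ| * u (1 + N)) else 0 := by
            have := hu.pos (1 + N) (by omega)
            split_ifs <;> positivity
          linarith
        · rw [if_neg h1, if_pos (not_le.1 h1), min_eq_right (not_le.1 h1).le]
          by_cases h2 : 1 ≤ |τ| * u (1 + N)
          · rw [if_pos h2, if_pos h2, min_eq_right h2]
            split_ifs <;> linarith
          · rw [if_neg h2, if_neg h2, if_neg fun h => h2 h.le]
            linarith [min_le_right (|τ| * u (1 + N)) 1]
      linarith
  -- The three contributions give 2A + 4, relaxed to 3A + 4 by A > 1.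
  have h1 := hu.sum_two_div_le τ N 1 le_rfl
  have h2 := hu.one_lt
  have h3 := min_le_right (|τ| * u (1 + N)) 1
  have h4 : (if 1 < |τ| * u (1 + N) then (3 : ℝ) else 0) ≤ 3 := by split_ifs <;> norm_num
  linarith

/-! ### Integrals over symmetric regions -/

/-- The set `{ξ | α ≤ |ξ| ≤ β}`. -/
def symmetricShell (α β : ℝ) : Set ℝ := {ξ | α ≤ |ξ| ∧ |ξ| ≤ β}

theorem truncRegion_eq_prod (α₁ β₁ α₂ β₂ : ℝ) :
    truncRegion α₁ β₁ α₂ β₂ = symmetricShell α₁ β₁ ×ˢ symmetricShell α₂ β₂ := rfl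

theorem symmetricShell_eq {α : ℝ} (hα : 0 < α) (β : ℝ) :
    symmetricShell α β = Icc (-β) (-α) ∪ Icc α β := by
  ext ξ
  simp only [symmetricShell, mem_ofPred_eq, mem_union, mem_Icc]
  rcases abs_cases ξ with ⟨h, h0⟩ | ⟨h, h0⟩ <;> rw [h]
  · exact ⟨Or.inr, fun h' => h'.resolve_left fun h'' => by linarith⟩
  · constructor
    · rintro ⟨h1, h2⟩; left; constructor <;> linarith
    · rintro (⟨h1, h2⟩ | ⟨h1, h2⟩) <;> constructor <;> linarith

theorem norm_integral_symmetricShell_le (τ : ℝ) {α β : ℝ} (hα : 0 < α) (hαβ : α ≤ β) :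
    ‖∫ ξ in symmetricShell α β, Complex.exp (Complex.I * ((τ * ξ : ℝ) : ℂ)) / ξ‖ ≤
      2 * |truncSine τ α β| := by
  set g : ℝ → ℂ := fun ξ => Complex.exp (Complex.I * ((τ * ξ : ℝ) : ℂ)) / ξ with hg
  have hβ := hα.trans_le hαβ
  have hcont : ∀ ξ : ℝ, ξ ≠ 0 → ContinuousAt g ξ := fun ξ hξ => by
    have : (ξ : ℂ) ≠ 0 := Complex.ofReal_ne_zero.2 hξ
    rw [hg]
    fun_prop (disch := assumption)
  have hc1 : ContinuousOn g (Icc α β) := fun ξ hξ =>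
    (hcont ξ (hα.trans_le hξ.1).ne').continuousWithinAt
  have hc2 : ContinuousOn g (Icc (-β) (-α)) := fun ξ hξ =>
    (hcont ξ (by linarith [hξ.2] : ξ < 0).ne).continuousWithinAt
  have hc3 : ContinuousOn (fun ξ => g (-ξ)) (Icc α β) := fun ξ hξ =>
    ((hcont (-ξ) (neg_ne_zero.2 (hα.trans_le hξ.1).ne')).comp
      (continuous_neg.continuousAt)).continuousWithinAt
  have hdisj : Disjoint (Icc (-β) (-α)) (Icc α β) := by
    rw [Set.disjoint_left]
    intro ξ h1 h2
    linarith [h1.2, h2.1]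
  -- Folding ξ to -ξ cancels the cosine part, which would not be bounded uniformly in τ.
  have hval : ∫ ξ in symmetricShell α β, g ξ = 2 * Complex.I * (truncSine τ α β : ℂ) := by
    rw [symmetricShell_eq hα, setIntegral_union hdisj measurableSet_Icc
      (hc2.integrableOn_compact isCompact_Icc) (hc1.integrableOn_compact isCompact_Icc),
      integral_Icc_eq_integral_Ioc, integral_Icc_eq_integral_Ioc,
      ← intervalIntegral.integral_of_le hαβ, ← intervalIntegral.integral_of_le (neg_le_neg hαβ),
      ← intervalIntegral.integral_comp_neg, ← intervalIntegral.integral_add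
        (hc3.intervalIntegrable_of_Icc hαβ) (hc1.intervalIntegrable_of_Icc hαβ), truncSine,
      ← intervalIntegral.integral_ofReal, ← intervalIntegral.integral_const_mul]
    refine intervalIntegral.integral_congr fun ξ hξ => ?_
    simp only [hg]
    push_cast
    rw [Complex.sin, mul_neg, div_neg]
    have : (ξ : ℂ) ≠ 0 := Complex.ofReal_ne_zero.2 ((lt_min hα hβ).trans_le hξ.1).ne'
    have e1 : Complex.I * (τ * ξ) = τ * ξ * Complex.I := by ring
    have e2 : Complex.I * -(τ * ξ : ℂ) = -(τ * ξ) * Complex.I := by ring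
    rw [e1, e2]
    field_simp
    linear_combination (Complex.exp (τ * ξ * Complex.I) - Complex.exp (-(τ * ξ * Complex.I))) *
      Complex.I_sq
  rw [hval, norm_mul, norm_mul, Complex.norm_I, Complex.norm_real, Real.norm_eq_abs]
  simp

/-- The function `ξ ↦ e^{i τ ξ} / ξ`. -/
def inverseKernel (τ ξ : ℝ) : ℂ := Complex.exp (Complex.I * ((τ * ξ : ℝ) : ℂ)) / ξ

theorem measurable_inverseKernel (τ : ℝ) : Measurable (inverseKernel τ) := by
  unfold inverseKernel; fun_prop

theorem norm_inverseKernel (τ ξ : ℝ) : ‖inverseKernel τ ξ‖ = 1 / |ξ| := by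
  rw [inverseKernel, norm_div, mul_comm, Complex.norm_exp_ofReal_mul_I, Complex.norm_real,
    Real.norm_eq_abs]

theorem measurableSet_symmetricShell (α β : ℝ) : MeasurableSet (symmetricShell α β) :=
  (continuous_abs (G := ℝ)).measurable (measurableSet_Icc (a := α) (b := β))

theorem isBounded_symmetricShell (α β : ℝ) : Bornology.IsBounded (symmetricShell α β) :=
  (Metric.isBounded_Icc (-β) β).subset fun _ h => abs_le.1 h.2

theorem integrableOn_inverseKernel (τ : ℝ) {α : ℝ} (hα : 0 < α) (β : ℝ) :
    IntegrableOn (inverseKernel τ) (symmetricShell α β) := by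
  refine IntegrableOn.of_bound (isBounded_symmetricShell α β).measure_lt_top
    (measurable_inverseKernel τ).aestronglyMeasurable (1 / α) ?_
  refine (ae_restrict_iff' (measurableSet_symmetricShell α β)).2 (ae_of_all _ fun ξ hξ => ?_)
  rw [norm_inverseKernel]
  exact one_div_le_one_div_of_le hα hξ.1

/-- The Fourier–Stieltjes sums of `f`, divided by `-ξη` and multiplied by `e^{i(xξ + yη)}`. -/
def inverseSum (f : ℝ × ℝ → ℝ) (x y : ℝ) (X Y : ℕ → ℝ) (n : ℕ) (p : ℝ × ℝ) : ℂ :=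
  -∑ i ∈ Finset.range n, ∑ j ∈ Finset.range n,
    (mixedDiff f (X i) (X (i + 1)) (Y j) (Y (j + 1)) : ℂ) *
      (inverseKernel (x - X (i + 1)) p.1 * inverseKernel (y - Y (j + 1)) p.2)

theorem measurable_inverseSum (f : ℝ × ℝ → ℝ) (x y : ℝ) (X Y : ℕ → ℝ) (n : ℕ) :
    Measurable (inverseSum f x y X Y n) := by
  refine (Finset.measurable_fun_sum _ fun i _ => Finset.measurable_fun_sum _ fun j _ => ?_).neg
  exact (((measurable_inverseKernel _).comp measurable_fst).mul
    ((measurable_inverseKernel _).comp measurable_snd)).const_mul _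

theorem inverseSum_eq (f : ℝ × ℝ → ℝ) (x y : ℝ) (X Y : ℕ → ℝ) (n : ℕ) (p : ℝ × ℝ) :
    inverseSum f x y X Y n p = -(p.1 * p.2 : ℂ)⁻¹ * stieltjesSum f X Y n p.1 p.2 *
      Complex.exp (Complex.I * ((x * p.1 + y * p.2 : ℝ) : ℂ)) := by
  rw [inverseSum, stieltjesSum, neg_mul, neg_mul, Finset.mul_sum, Finset.sum_mul]
  congr 1
  refine Finset.sum_congr rfl fun i _ => ?_
  rw [Finset.mul_sum, Finset.sum_mul]
  refine Finset.sum_congr rfl fun j _ => ?_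
  have hexp : Complex.exp (Complex.I * (((x - X (i + 1)) * p.1 : ℝ) : ℂ)) *
      Complex.exp (Complex.I * (((y - Y (j + 1)) * p.2 : ℝ) : ℂ)) =
      phase p.1 (X (i + 1)) * phase p.2 (Y (j + 1)) *
        Complex.exp (Complex.I * ((x * p.1 + y * p.2 : ℝ) : ℂ)) := by
    simp only [phase, ← Complex.exp_add]
    congr 1
    push_cast
    ring
  rw [inverseKernel, inverseKernel, div_mul_div_comm, hexp, mul_inv]
  ring

/-- The bound depends on the outer radii only through `q₁` and `q₂`, so it survives the suprema over
a block. The factor 4 collects a 2 from each variable. -/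
theorem norm_integral_inverseSum_le (f : ℝ × ℝ → ℝ) (x y : ℝ) (X Y : ℕ → ℝ) (n : ℕ)
    {α₁ β₁ α₂ β₂ q₁ q₂ : ℝ} (h₁ : 0 < α₁) (h₂ : 0 < α₂) (hβ₁ : α₁ ≤ β₁) (hβ₂ : α₂ ≤ β₂)
    (hq₁ : β₁ ≤ q₁) (hq₂ : β₂ ≤ q₂) :
    ‖∫ p in truncRegion α₁ β₁ α₂ β₂, inverseSum f x y X Y n p‖ ≤
      4 * ∑ i ∈ Finset.range n, ∑ j ∈ Finset.range n,
        |mixedDiff f (X i) (X (i + 1)) (Y j) (Y (j + 1))| *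
          (sineBound (x - X (i + 1)) α₁ q₁ * sineBound (y - Y (j + 1)) α₂ q₂) := by
  have hint : ∀ σ τ : ℝ, IntegrableOn (fun p : ℝ × ℝ => inverseKernel σ p.1 * inverseKernel τ p.2)
      (truncRegion α₁ β₁ α₂ β₂) := fun σ τ => by
    rw [truncRegion_eq_prod, IntegrableOn, Measure.volume_eq_prod, ← Measure.prod_restrict]
    exact (integrableOn_inverseKernel σ h₁ β₁).mul_prod (integrableOn_inverseKernel τ h₂ β₂)
  have hval : ∀ σ τ : ℝ, ‖∫ p in truncRegion α₁ β₁ α₂ β₂, inverseKernel σ p.1 * inverseKernel τ p.2‖ ≤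
      4 * (sineBound σ α₁ q₁ * sineBound τ α₂ q₂) := fun σ τ => by
    rw [truncRegion_eq_prod, Measure.volume_eq_prod, setIntegral_prod_mul, norm_mul]
    calc _ ≤ (2 * |truncSine σ α₁ β₁|) * (2 * |truncSine τ α₂ β₂|) :=
          mul_le_mul (norm_integral_symmetricShell_le σ h₁ hβ₁)
            (norm_integral_symmetricShell_le τ h₂ hβ₂) (norm_nonneg _) (by positivity)
      _ ≤ (2 * sineBound σ α₁ q₁) * (2 * sineBound τ α₂ q₂) := by
          have b1 := abs_truncSine_le_sineBound σ h₁ hβ₁ hq₁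
          have b2 := abs_truncSine_le_sineBound τ h₂ hβ₂ hq₂
          have := (abs_nonneg _).trans b1
          gcongr
      _ = _ := by ring
  simp only [inverseSum]
  rw [integral_neg, norm_neg, integral_finsetSum _
    (fun i _ => integrable_finsetSum _ fun j _ => (hint _ _).const_mul _), Finset.mul_sum]
  refine norm_sum_le_of_le _ fun i _ => ?_
  rw [integral_finsetSum _ (fun j _ => (hint _ _).const_mul _), Finset.mul_sum]
  refine norm_sum_le_of_le _ fun j _ => ?_
  rw [integral_const_mul, norm_mul, Complex.norm_real, Real.norm_eq_abs, mul_left_comm]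
  exact mul_le_mul_of_nonneg_left (hval _ _) (abs_nonneg _)

/-! ### Passage to the limit and summation over blocks -/

/-- The suprema are chosen independently at each index, and two choices are dominated by taking the
better one at every index. It thus suffices to bound the sum for each fixed choice of outer radii.
-/
theorem sum_iSup_eq_iSup_sum {ι : Type*} {κ : ι → Type*} [∀ a, Nonempty (κ a)] (F : Finset ι)
    (g : ∀ a, κ a → ℝ≥0∞) :
    ∑ a ∈ F, ⨆ k, g a k = ⨆ c : ∀ a, κ a, ∑ a ∈ F, g a (c a) := by
  rw [← ENNReal.finsetSum_iSup]
  · exact Finset.sum_congr rfl fun a _ => ((Function.surjective_eval a).iSup_comp (g a)).symm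
  · intro c c'
    classical
    refine ⟨fun a => if g a (c a) ≤ g a (c' a) then c' a else c a, fun a => ?_⟩
    dsimp only
    split_ifs with h
    · exact ⟨h, le_rfl⟩
    · exact ⟨le_rfl, (not_le.1 h).le⟩

/-- The shift of the index set `ℕ × ℕ` by `(2, 2)`. -/
def shiftPairEquiv : ℕ × ℕ ≃ {p : ℕ × ℕ // 2 ≤ p.1 ∧ 2 ≤ p.2} where
  toFun p := ⟨(1 + p.1 + 1, 1 + p.2 + 1), by constructor <;> dsimp only <;> omega⟩
  invFun q := (q.1.1 - 2, q.1.2 - 2)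
  left_inv p := by ext <;> dsimp only <;> omega
  right_inv q := by
    have h1 := q.2.1
    have h2 := q.2.2
    ext <;> dsimp only <;> omega

section

variable {f : ℝ × ℝ → ℝ} {V e W d : ℝ → ℝ} {C : ℝ}

theorem StripControl.sum_sum_abs_mixedDiff_le (h : StripControl f V e C) {x y : ℕ → ℝ}
    (hx : Monotone x) (hy : Monotone y) (n : ℕ) :
    ∑ i ∈ Finset.range n, ∑ j ∈ Finset.range n,
      |mixedDiff f (x i) (x (i + 1)) (y j) (y (j + 1))| ≤ C := by
  calc _ ≤ ∑ i ∈ Finset.range n, (V (x (i + 1)) - V (x i)) :=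
        Finset.sum_le_sum fun i _ => h.mixed _ _ (hx i.le_succ) n y hy
    _ = V (x n) - V (x 0) := Finset.sum_range_sub (fun i => V (x i)) n
    _ ≤ C := by linarith [h.le (x n), h.nonneg (x 0)]

/-- The approximations of `inverseIntegrand f x y` by Fourier–Stieltjes sums. -/
def squareInverseSum (f : ℝ × ℝ → ℝ) (x y : ℝ) (N : ℕ) (p : ℝ × ℝ) : ℂ :=
  inverseSum f x y (uniformGrid (-(N + 1 : ℕ)) (N + 1 : ℕ) ((N + 1) ^ 3))
    (uniformGrid (-(N + 1 : ℕ)) (N + 1 : ℕ) ((N + 1) ^ 3)) ((N + 1) ^ 3) p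

theorem monotone_squareGrid (N : ℕ) :
    Monotone (uniformGrid (-(N + 1 : ℕ)) (N + 1 : ℕ) ((N + 1) ^ 3)) :=
  monotone_uniformGrid (by
    have : (0 : ℝ) ≤ (N + 1 : ℕ) := by positivity
    linarith) _

theorem tendsto_squareInverseSum (h : StripControl f V e C)
    (h' : StripControl (f ∘ Prod.swap) W d C) (x y : ℝ) {p : ℝ × ℝ} (h1 : p.1 ≠ 0) (h2 : p.2 ≠ 0) :
    Tendsto (fun N => squareInverseSum f x y N p) atTop (𝓝 (inverseIntegrand f x y p)) := by
  have h1' : (p.1 : ℂ) ≠ 0 := Complex.ofReal_ne_zero.2 h1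
  have h2' : (p.2 : ℂ) ≠ 0 := Complex.ofReal_ne_zero.2 h2
  have := ((tendsto_squareStieltjesSum h h' h1 h2).const_mul (-(p.1 * p.2 : ℂ)⁻¹)).mul_const
    (Complex.exp (Complex.I * ((x * p.1 + y * p.2 : ℝ) : ℂ)))
  rw [← mul_assoc (-(p.1 * p.2 : ℂ)⁻¹), neg_mul_neg, inv_mul_cancel₀ (mul_ne_zero h1' h2'),
    one_mul] at this
  exact this.congr fun N => (inverseSum_eq _ _ _ _ _ _ _).symm

theorem norm_squareInverseSum_le (h : StripControl f V e C) (x y : ℝ) (N : ℕ) {α₁ β₁ α₂ β₂ : ℝ}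
    (h₁ : 0 < α₁) (h₂ : 0 < α₂) {p : ℝ × ℝ} (hp : p ∈ truncRegion α₁ β₁ α₂ β₂) :
    ‖squareInverseSum f x y N p‖ ≤ C * (1 / α₁ * (1 / α₂)) := by
  have hg := monotone_squareGrid N
  rw [squareInverseSum, inverseSum, norm_neg]
  refine le_trans ?_ (mul_le_mul_of_nonneg_right
    (h.sum_sum_abs_mixedDiff_le hg hg ((N + 1) ^ 3)) (by positivity))
  simp only [Finset.sum_mul]
  refine norm_sum_le_of_le _ fun i _ => norm_sum_le_of_le _ fun j _ => ?_
  rw [norm_mul, norm_mul, Complex.norm_real, Real.norm_eq_abs, norm_inverseKernel,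
    norm_inverseKernel]
  have := hp.1.1
  have := hp.2.1
  gcongr

theorem measurableSet_truncRegion (α₁ β₁ α₂ β₂ : ℝ) :
    MeasurableSet (truncRegion α₁ β₁ α₂ β₂) :=
  (measurableSet_symmetricShell α₁ β₁).prod (measurableSet_symmetricShell α₂ β₂)

theorem volume_truncRegion_lt_top (α₁ β₁ α₂ β₂ : ℝ) : volume (truncRegion α₁ β₁ α₂ β₂) < ∞ :=
  ((isBounded_symmetricShell α₁ β₁).prod (isBounded_symmetricShell α₂ β₂)).measure_lt_top

/-- Away from the axes the approximating sums are bounded by C/(α₁α₂) on a set of finite measure, so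
dominated convergence applies. -/
theorem integrableOn_inverseIntegrand (h : StripControl f V e C)
    (h' : StripControl (f ∘ Prod.swap) W d C) (x y : ℝ) {α₁ α₂ : ℝ} (β₁ β₂ : ℝ)
    (h₁ : 0 < α₁) (h₂ : 0 < α₂) :
    IntegrableOn (inverseIntegrand f x y) (truncRegion α₁ β₁ α₂ β₂) ∧
      Tendsto (fun N => ∫ p in truncRegion α₁ β₁ α₂ β₂, squareInverseSum f x y N p) atTop
        (𝓝 (∫ p in truncRegion α₁ β₁ α₂ β₂, inverseIntegrand f x y p)) := by
  have hms := measurableSet_truncRegion α₁ β₁ α₂ β₂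
  have hfin := volume_truncRegion_lt_top α₁ β₁ α₂ β₂
  have hlim : ∀ p ∈ truncRegion α₁ β₁ α₂ β₂,
      Tendsto (fun N => squareInverseSum f x y N p) atTop (𝓝 (inverseIntegrand f x y p)) :=
    fun p hp => tendsto_squareInverseSum h h' x y (abs_pos.1 (h₁.trans_le hp.1.1))
      (abs_pos.1 (h₂.trans_le hp.2.1))
  have hmeas : ∀ N, AEStronglyMeasurable (squareInverseSum f x y N)
      (volume.restrict (truncRegion α₁ β₁ α₂ β₂)) := fun N =>
    (measurable_inverseSum f x y _ _ _).aestronglyMeasurable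
  have hae := (ae_restrict_iff' hms (μ := volume)).2 (ae_of_all _ hlim)
  refine ⟨IntegrableOn.of_bound hfin (aestronglyMeasurable_of_tendsto_ae atTop hmeas hae)
    (C * (1 / α₁ * (1 / α₂))) ?_, ?_⟩
  · refine (ae_restrict_iff' hms).2 (ae_of_all _ fun p hp => ?_)
    exact le_of_tendsto' (hlim p hp).norm fun N => norm_squareInverseSum_le h x y N h₁ h₂ hp
  · refine tendsto_integral_of_dominated_convergence (fun _ => C * (1 / α₁ * (1 / α₂))) hmeas
      (integrableOn_const hfin.ne) (fun N => ?_) hae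
    exact (ae_restrict_iff' hms).2 (ae_of_all _ fun p hp =>
      norm_squareInverseSum_le h x y N h₁ h₂ hp)

theorem sineBound_nonneg (τ : ℝ) {p q : ℝ} (hp : 0 < p) (hpq : p ≤ q) : 0 ≤ sineBound τ p q :=
  (abs_nonneg _).trans (abs_truncSine_le_sineBound τ hp le_rfl hpq)

theorem sum_norm_truncInverse_le (h : StripControl f V e C)
    (h' : StripControl (f ∘ Prod.swap) W d C) {u v : ℕ → ℝ} {A₁ A₂ : ℝ} (hu : LacunaryWith u A₁)
    (hv : LacunaryWith v A₂) (x y : ℝ) (F : Finset (ℕ × ℕ)) (s t : ℕ × ℕ → ℝ)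
    (hs : ∀ p, s p ∈ Icc (u (1 + p.1)) (u (1 + p.1 + 1)))
    (ht : ∀ p, t p ∈ Icc (v (1 + p.2)) (v (1 + p.2 + 1))) :
    ∑ p ∈ F, ‖truncInverse f x y (u (1 + p.1)) (s p) (v (1 + p.2)) (t p)‖ ≤
      (3 * A₁ + 4) * (3 * A₂ + 4) / Real.pi ^ 2 * C := by
  have hu0 : ∀ i, 0 < u (1 + i) := fun i => hu.pos _ (by omega)
  have hv0 : ∀ i, 0 < v (1 + i) := fun i => hv.pos _ (by omega)
  have hum : ∀ i, u (1 + i) ≤ u (1 + i + 1) := fun i => hu.mono _ (by omega)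
  have hvm : ∀ i, v (1 + i) ≤ v (1 + i + 1) := fun i => hv.mono _ (by omega)
  have hbu : ∀ τ i, 0 ≤ sineBound τ (u (1 + i)) (u (1 + i + 1)) := fun τ i =>
    sineBound_nonneg τ (hu0 i) (hum i)
  have hbv : ∀ τ i, 0 ≤ sineBound τ (v (1 + i)) (v (1 + i + 1)) := fun τ i =>
    sineBound_nonneg τ (hv0 i) (hvm i)
  have hA₁ : 0 ≤ 3 * A₁ + 4 := by linarith [hu.one_lt]
  have hA₂ : 0 ≤ 3 * A₂ + 4 := by linarith [hv.one_lt]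
  have hprod : ∀ σ τ, ∑ p ∈ F, sineBound σ (u (1 + p.1)) (u (1 + p.1 + 1)) *
      sineBound τ (v (1 + p.2)) (v (1 + p.2 + 1)) ≤ (3 * A₁ + 4) * (3 * A₂ + 4) := by
    intro σ τ
    -- `F` is enclosed in a square of indices, over which the sum of products factors.
    obtain ⟨M, hM⟩ := (F.image Prod.fst ∪ F.image Prod.snd).exists_nat_subset_range
    have hF : F ⊆ Finset.range M ×ˢ Finset.range M := fun p hp => Finset.mem_product.2
      ⟨hM (Finset.mem_union_left _ (Finset.mem_image_of_mem _ hp)),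
        hM (Finset.mem_union_right _ (Finset.mem_image_of_mem _ hp))⟩
    calc _ ≤ ∑ p ∈ Finset.range M ×ˢ Finset.range M, sineBound σ (u (1 + p.1)) (u (1 + p.1 + 1)) *
          sineBound τ (v (1 + p.2)) (v (1 + p.2 + 1)) :=
          Finset.sum_le_sum_of_subset_of_nonneg hF fun p _ _ => mul_nonneg (hbu _ _) (hbv _ _)
      _ = (∑ i ∈ Finset.range M, sineBound σ (u (1 + i)) (u (1 + i + 1))) *
          ∑ j ∈ Finset.range M, sineBound τ (v (1 + j)) (v (1 + j + 1)) := by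
          rw [Finset.sum_product, Finset.sum_mul_sum]
      _ ≤ _ := mul_le_mul (hu.sum_sineBound_le σ M) (hv.sum_sineBound_le τ M)
          (Finset.sum_nonneg fun _ _ => hbv _ _) hA₁
  have hπ : ‖(1 / (4 * (Real.pi : ℂ) ^ 2))‖ = 1 / (4 * Real.pi ^ 2) := by
    simp [abs_of_pos Real.pi_pos]
  have hlim : Tendsto (fun N => ∑ p ∈ F, ‖(1 / (4 * (Real.pi : ℂ) ^ 2)) *
      ∫ q in truncRegion (u (1 + p.1)) (s p) (v (1 + p.2)) (t p), squareInverseSum f x y N q‖) atTop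
      (𝓝 (∑ p ∈ F, ‖truncInverse f x y (u (1 + p.1)) (s p) (v (1 + p.2)) (t p)‖)) :=
    tendsto_finsetSum _ fun p _ =>
      ((integrableOn_inverseIntegrand h h' x y _ _ (hu0 p.1) (hv0 p.2)).2.const_mul _).norm
  refine le_of_tendsto' hlim fun N => ?_
  have hg := monotone_squareGrid N
  set X := uniformGrid (-(N + 1 : ℕ)) (N + 1 : ℕ) ((N + 1) ^ 3) with hX
  set n := (N + 1) ^ 3 with hn
  calc _ ≤ ∑ p ∈ F, 1 / (4 * Real.pi ^ 2) * (4 * ∑ i ∈ Finset.range n, ∑ j ∈ Finset.range n,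
          |mixedDiff f (X i) (X (i + 1)) (X j) (X (j + 1))| *
            (sineBound (x - X (i + 1)) (u (1 + p.1)) (u (1 + p.1 + 1)) *
              sineBound (y - X (j + 1)) (v (1 + p.2)) (v (1 + p.2 + 1)))) := by
        refine Finset.sum_le_sum fun p _ => ?_
        rw [norm_mul, hπ]
        refine mul_le_mul_of_nonneg_left ?_ (by positivity)
        exact norm_integral_inverseSum_le f x y X X n (hu0 p.1) (hv0 p.2) (hs p).1 (ht p).1
          (hs p).2 (ht p).2
    _ = 1 / Real.pi ^ 2 * ∑ i ∈ Finset.range n, ∑ j ∈ Finset.range n,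
          |mixedDiff f (X i) (X (i + 1)) (X j) (X (j + 1))| *
            ∑ p ∈ F, sineBound (x - X (i + 1)) (u (1 + p.1)) (u (1 + p.1 + 1)) *
              sineBound (y - X (j + 1)) (v (1 + p.2)) (v (1 + p.2 + 1)) := by
        rw [← Finset.mul_sum, ← Finset.mul_sum, Finset.sum_comm]
        simp only [Finset.sum_comm (s := F), Finset.mul_sum (s := F)]
        rw [← mul_assoc]
        congr 1
        have := Real.pi_ne_zero
        field_simp
    _ ≤ 1 / Real.pi ^ 2 * ∑ i ∈ Finset.range n, ∑ j ∈ Finset.range n,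
          |mixedDiff f (X i) (X (i + 1)) (X j) (X (j + 1))| *
            ((3 * A₁ + 4) * (3 * A₂ + 4)) := by
        gcongr with i _ j _
        exact hprod _ _
    _ = 1 / Real.pi ^ 2 * ((∑ i ∈ Finset.range n, ∑ j ∈ Finset.range n,
          |mixedDiff f (X i) (X (i + 1)) (X j) (X (j + 1))|) *
            ((3 * A₁ + 4) * (3 * A₂ + 4))) := by
        simp only [Finset.sum_mul]
    _ ≤ 1 / Real.pi ^ 2 * (C * ((3 * A₁ + 4) * (3 * A₂ + 4))) := by
        gcongr
        exact h.sum_sum_abs_mixedDiff_le hg hg n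
    _ = _ := by ring

end

end

theorem theorem4p2 (f : ℝ × ℝ → ℝ) (hf : IsBVVanishing f)
    (u v : ℕ → ℝ) (A₁ A₂ : ℝ) (hu : LacunaryWith u A₁) (hv : LacunaryWith v A₂) :
    (∀ ξ η : ℝ, ξ ≠ 0 → η ≠ 0 → HasKPFourier f ξ η (kpFourier f ξ η)) ∧
    ∀ x y : ℝ,
      (∀ α₁ β₁ α₂ β₂ : ℝ, 0 < α₁ → 0 < α₂ →
        IntegrableOn (inverseIntegrand f x y) (truncRegion α₁ β₁ α₂ β₂)) ∧
      -- the blocks `[u (i - 1), u i] × [v (j - 1), v j]` with `i, j ≥ 2`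
      ∑' p : {p : ℕ × ℕ // 2 ≤ p.1 ∧ 2 ≤ p.2},
          (⨆ s ∈ Icc (u (p.1.1 - 1)) (u p.1.1), ⨆ t ∈ Icc (v (p.1.2 - 1)) (v p.1.2),
            ‖truncInverse f x y (u (p.1.1 - 1)) s (v (p.1.2 - 1)) t‖ₑ)
        ≤ ENNReal.ofReal ((3 * A₁ + 4) * (3 * A₂ + 4) / Real.pi ^ 2) * vitaliVar f univ := by
  obtain ⟨V, e, h⟩ := exists_stripControl hf
  obtain ⟨W, d, h'⟩ := exists_stripControl_swap hf
  refine ⟨fun ξ η hξ hη => h.hasKPFourier h' hξ hη, fun x y =>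
    ⟨fun α₁ β₁ α₂ β₂ h₁ h₂ => (integrableOn_inverseIntegrand h h' x y β₁ β₂ h₁ h₂).1, ?_⟩⟩
  rw [← shiftPairEquiv.tsum_eq, ENNReal.tsum_eq_iSup_sum]
  refine iSup_le fun F => ?_
  have hnonneg : 0 ≤ (3 * A₁ + 4) * (3 * A₂ + 4) / Real.pi ^ 2 := by
    have := hu.one_lt
    have := hv.one_lt
    positivity
  have hne : ∀ p : ℕ × ℕ, Nonempty (Icc (u (1 + p.1)) (u (1 + p.1 + 1)) ×
      Icc (v (1 + p.2)) (v (1 + p.2 + 1))) := fun p =>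
    ⟨⟨⟨_, left_mem_Icc.2 (hu.mono _ (by omega))⟩, ⟨_, left_mem_Icc.2 (hv.mono _ (by omega))⟩⟩⟩
  calc _ = ∑ p ∈ F, ⨆ k : Icc (u (1 + p.1)) (u (1 + p.1 + 1)) × Icc (v (1 + p.2)) (v (1 + p.2 + 1)),
        ‖truncInverse f x y (u (1 + p.1)) k.1 (v (1 + p.2)) k.2‖ₑ := by
        refine Finset.sum_congr rfl fun p _ => ?_
        rw [iSup_prod, iSup_subtype']
        refine iSup_congr fun s => ?_
        rw [iSup_subtype']
        -- Here `1 + p.1 + 1 - 1` reduces definitionally to `1 + p.1`, which is why the shift has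
        -- this form.
        rfl
    _ ≤ _ := by
        rw [sum_iSup_eq_iSup_sum]
        refine iSup_le fun c => ?_
        have key := sum_norm_truncInverse_le h h' hu hv x y F (fun p => (c p).1) (fun p => (c p).2)
          (fun p => (c p).1.2) (fun p => (c p).2.2)
        simp only [← ofReal_norm]
        rw [← ENNReal.ofReal_sum_of_nonneg fun _ _ => norm_nonneg _,
          ← ENNReal.ofReal_toReal hf.var_lt_top.ne, ← ENNReal.ofReal_mul hnonneg]
        exact ENNReal.ofReal_le_ofReal key
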